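/- Consider real solutions $y$ of the first Painlev\'e equation $y''=6y^2-x$, each taken on its interval of existence $(a,b)$, the maximal open real interval on which it is defined. For $x_0\le 0$ define the following infima, with values a priori in $[-\infty,+\infty]$: - $X(x_0)$ is the infimum of the left endpoints $a$ of the intervals of existence of all solutions regular at $x_0$ (that is, with $x_0\in(a,b)$); - $X_-(x_0)$ is the infimum of $a$ over those solutions regular at $x_0$ with $y'(x_0)\le 0$; - $X_{min}(x_0)$ is the infimum of the points $x_{min}<x_0$ at which a solution regular at $x_0$ with $y'(x_0)\ge 0$ attains its minimum on $(a,x_0]$. Let $$C=\max_{v<0}\int_0^{+\infty}\frac{dw}{\sqrt{w^4+3vw^2+3v^2+1/2}},$$ and for $x_0\le0$ let $\eta(x_0)$ be the unique positive root of $\eta^5-|x_0|\eta=C$. (The maximum exists, and so does the unique positive root.) Then for every $x_0\le 0$ the values $X_{min}(x_0)$, $X_-(x_0)$ and $X(x_0)$ are finite, and $$X_-(X_{min}(x_0))\le X(x_0)<x_0-\frac{2^{4/5}C}{\eta(x_0/2^{4/5})}.$$ Moreover, for every $x_0<0$, $$x_0-\frac{C}{|x_0|^{1/4}}-\frac{C}{\eta(x_0)}<X_{min}(x_0)-\frac{C}{|X_{min}(x_0)|^{1/4}}<X(x_0)<x_0-\frac{2^{4/5}C}{|X_{min}(x_0/2^{4/5})|^{1/4}}<x_0-\frac{2C}{\big||x_0|+2C/|x_0|^{1/4}\big|^{1/4}}.$$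 In particular, as $x_0\to-\infty$, $$X(x_0)=x_0-\frac{2C}{|x_0|^{1/4}}+\mathcal O\big(|x_0|^{-3/2}\big),$$ and for $x_0\le 0$ with $|x_0|>(2C)^{4/5}$ the error term satisfies $$0<X(x_0)-x_0+\frac{2C}{|x_0|^{1/4}}<\frac{C^2}{|x_0|^{3/2}}.$$ -/

import Mathlib

namespace PainleveOne

/-- `y` solves `y'' = 6 y ^ 2 - x` at every point of the set `I`. -/
def SolvesOn (y : ℝ → ℝ) (I : Set ℝ) : Prop :=
  ∀ x ∈ I, DifferentiableAt ℝ y x ∧ HasDerivAt (deriv y) (6 * y x ^ 2 - x) x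

/-- `y` is a real solution with interval of existence `I`: `I` is an open interval on which `y`
solves the equation, and `y` has no extension to a solution on a larger open interval.
(Only the values of `y` on `I` matter.) -/
structure IsSolution (y : ℝ → ℝ) (I : Set ℝ) : Prop where
  isOpen : IsOpen I
  isPreconnected : IsPreconnected I
  solves : SolvesOn y I
  maximal : ∀ (z : ℝ → ℝ) (J : Set ℝ), IsOpen J → IsPreconnected J → SolvesOn z J → I ⊆ J →
    Set.EqOn z y I → J ⊆ I

/-- The left endpoint of an interval, possibly `-∞`. -/
noncomputable def leftEnd (I : Set ℝ) : EReal := ⨅ x ∈ I, (x : EReal)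

/-- Infimum of the left endpoints of the intervals of existence of all solutions regular at `x₀`,
with values in `[-∞, ∞]`. -/
noncomputable def extX (x₀ : ℝ) : EReal :=
  sInf {a | ∃ (y : ℝ → ℝ) (I : Set ℝ), IsSolution y I ∧ x₀ ∈ I ∧ a = leftEnd I}

/-- The same infimum, over the solutions with `y' x₀ ≤ 0` only. -/
noncomputable def extXminus (x₀ : ℝ) : EReal :=
  sInf {a | ∃ (y : ℝ → ℝ) (I : Set ℝ), IsSolution y I ∧ x₀ ∈ I ∧ deriv y x₀ ≤ 0 ∧ a = leftEnd I}

/-- Infimum of the points `m < x₀` at which some solution regular at `x₀`, with `0 ≤ y' x₀`,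
attains its minimum to the left of `x₀`. -/
noncomputable def extXmin (x₀ : ℝ) : EReal :=
  sInf {a | ∃ (y : ℝ → ℝ) (I : Set ℝ) (m : ℝ), IsSolution y I ∧ x₀ ∈ I ∧ 0 ≤ deriv y x₀ ∧
    m ∈ I ∧ m < x₀ ∧ IsMinOn y (I ∩ Set.Iic x₀) m ∧ a = (m : EReal)}

/-- Real values of the three infima (meaningful where the infima are finite). -/
noncomputable def X (x₀ : ℝ) : ℝ := (extX x₀).toReal

noncomputable def Xminus (x₀ : ℝ) : ℝ := (extXminus x₀).toReal

noncomputable def Xmin (x₀ : ℝ) : ℝ := (extXmin x₀).toReal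

/-- The integral `∫₀^∞ dw / √(w⁴ + 3 v w² + 3 v² + 1/2)`. -/
noncomputable def integralI (v : ℝ) : ℝ :=
  ∫ w in Set.Ioi (0 : ℝ), 1 / √(w ^ 4 + 3 * v * w ^ 2 + 3 * v ^ 2 + 1 / 2)

/-- The constant `C`, the maximum of `integralI` over `v < 0`. -/
noncomputable def C : ℝ := sSup (integralI '' Set.Iio 0)

/-- The positive roots of `η ^ 5 - |x₀| η = C`. -/
def etaRoots (x₀ : ℝ) : Set ℝ := {h | 0 < h ∧ h ^ 5 - |x₀| * h = C}

/-- The positive root of `η ^ 5 - |x₀| η = C`. -/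
noncomputable def eta (x₀ : ℝ) : ℝ := sSup (etaRoots x₀)

end PainleveOne

open scoped Asymptotics

/-!
For fixed `c > 0`, the motion `u'' = 6 u ^ 2 + c` starting at rest in `v` blows up after the time
`blowupTime v c`, an integral that substituting `s = √(u - v)` in the energy identity turns into
the one defining `C`. By scaling, its maximum over `v` is `C / c ^ (1 / 4)`.

Along a solution of Painlevé I the coefficient `-x` takes the place of `c`. If it stays above `c`,
comparing energies shows that a motion with nonnegative initial velocity lives for less than
`C / c ^ (1 / 4)`; run in both directions this bounds `Xminus` and `Xmin` from below. If it stays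
below `c`, a motion starting at rest outlives the blow-up time, so the solutions at rest in a
maximizing `v` bound `Xmin` and `X` from above. Finally, a solution either has nonpositive slope
at `Xmin x₀` or would have its minimum to the left of it, so `Xminus (Xmin x₀) ≤ X x₀`.
-/

namespace PainleveOne

open Set Filter Topology MeasureTheory

/-! ### Local theory of the equation -/

section AutonomousODE

variable {E : Type*} [NormedAddCommGroup E] [NormedSpace ℝ E] {v : E → E}

theorem eqOn_of_hasDerivAt_of_contDiff (hv : ContDiff ℝ 1 v) {f g : ℝ → E} {I : Set ℝ}
    (hIo : IsOpen I) (hI : IsPreconnected I) (hf : ∀ t ∈ I, HasDerivAt f (v (f t)) t)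
    (hg : ∀ t ∈ I, HasDerivAt g (v (g t)) t) {τ : ℝ} (hτ : τ ∈ I) (h : f τ = g τ) :
    EqOn f g I := by
  have agreement_locally_constant : ∀ t ∈ I, ∀ᶠ s in 𝓝[I] t, f t = g t ↔ f s = g s := by
    intro t ht
    apply mem_nhdsWithin_of_mem_nhds
    by_cases heq : f t = g t
    · obtain ⟨K, V, hV, hK⟩ := hv.contDiffAt.exists_lipschitzOnWith (x := f t)
      have heventually : f =ᶠ[𝓝 t] g := by
        refine ODE_solution_unique_of_eventually (v := fun _ => v) (s := fun _ => V) (K := K)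
          (.of_forall fun _ => hK) ?_ ?_ heq
        · filter_upwards [hIo.mem_nhds ht, (hf t ht).continuousAt hV] with s hs hsV
          exact ⟨hf s hs, hsV⟩
        · filter_upwards [hIo.mem_nhds ht, (hg t ht).continuousAt (heq ▸ hV)] with s hs hsV
          exact ⟨hg s hs, hsV⟩
      filter_upwards [heventually] with s hs using iff_of_true heq hs
    · have hfg := (hf t ht).continuousAt.sub (hg t ht).continuousAt
      filter_upwards [hfg.eventually_ne (sub_ne_zero.2 heq)] with s hs
        using iff_of_false heq (sub_ne_zero.1 hs)
  intro t ht
  refine (hI.induction₂ (fun s t => f s = g s ↔ f t = g t) agreement_locally_constant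
    (fun _ _ _ _ _ _ => Iff.trans) (fun _ _ _ _ => Iff.symm) hτ ht).1 h

theorem exists_uniform_time_of_isCompact [CompleteSpace E] (hv : ContDiff ℝ 1 v) {K : Set E}
    (hK : IsCompact K) :
    ∃ ε > 0, ∀ z ∈ K, ∀ τ : ℝ, ∃ α : ℝ → E, α τ = z ∧
      ∀ t ∈ Ioo (τ - ε) (τ + ε), HasDerivAt α (v (α t)) t := by
  refine hK.induction_on (p := fun S => ∃ ε > 0, ∀ z ∈ S, ∀ τ : ℝ, ∃ α : ℝ → E, α τ = z ∧
      ∀ t ∈ Ioo (τ - ε) (τ + ε), HasDerivAt α (v (α t)) t) ⟨1, one_pos, by simp⟩ ?_ ?_ ?_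
  · rintro S T hST ⟨ε, hε, H⟩
    exact ⟨ε, hε, fun z hz => H z (hST hz)⟩
  · rintro S T ⟨ε, hε, H⟩ ⟨ε', hε', H'⟩
    refine ⟨min ε ε', lt_min hε hε', fun z hz τ => ?_⟩
    rcases hz with hz | hz
    · obtain ⟨α, h0, hα⟩ := H z hz τ
      exact ⟨α, h0, fun t ht => hα t (Ioo_subset_Ioo (by gcongr; simp) (by gcongr; simp) ht)⟩
    · obtain ⟨α, h0, hα⟩ := H' z hz τ
      exact ⟨α, h0, fun t ht => hα t (Ioo_subset_Ioo (by gcongr; simp) (by gcongr; simp) ht)⟩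
  · intro z _
    obtain ⟨r, hr, ε, hε, H⟩ :=
      hv.contDiffAt.exists_forall_mem_closedBall_exists_eq_forall_mem_Ioo_hasDerivAt
        (x₀ := z) 0
    refine ⟨_, mem_nhdsWithin_of_mem_nhds (Metric.closedBall_mem_nhds z hr), ε, hε,
      fun w hw τ => ?_⟩
    obtain ⟨α, h0, hα⟩ := H w hw
    refine ⟨fun t => α (t - τ), by simpa using h0, fun t ht => ?_⟩
    exact (hα (t - τ) ⟨by linarith [ht.1], by linarith [ht.2]⟩).comp_sub_const t τ

end AutonomousODE

section Solutions

variable {y w : ℝ → ℝ} {I J : Set ℝ}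

/-- The autonomous vector field on phase space `(y, y', x)` that encodes the equation. -/
def phaseField (z : ℝ × ℝ × ℝ) : ℝ × ℝ × ℝ := (z.2.1, 6 * z.1 ^ 2 - z.2.2, 1)

/-- The curve `(y, y', x)` that `y` traces in phase space. -/
noncomputable def phaseCurve (y : ℝ → ℝ) (x : ℝ) : ℝ × ℝ × ℝ := (y x, deriv y x, x)

theorem contDiff_phaseField : ContDiff ℝ 1 phaseField := by
  unfold phaseField
  fun_prop

theorem SolvesOn.hasDerivAt (h : SolvesOn y I) {x : ℝ} (hx : x ∈ I) :
    HasDerivAt y (deriv y x) x :=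
  (h x hx).1.hasDerivAt

theorem SolvesOn.hasDerivAt_deriv (h : SolvesOn y I) {x : ℝ} (hx : x ∈ I) :
    HasDerivAt (deriv y) (6 * y x ^ 2 - x) x :=
  (h x hx).2

theorem SolvesOn.hasDerivAt_phaseCurve (h : SolvesOn y I) {x : ℝ} (hx : x ∈ I) :
    HasDerivAt (phaseCurve y) (phaseField (phaseCurve y x)) x :=
  (h.hasDerivAt hx).prodMk ((h.hasDerivAt_deriv hx).prodMk (hasDerivAt_id x))

theorem SolvesOn.mono (h : SolvesOn y I) (hJ : J ⊆ I) : SolvesOn y J :=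
  fun x hx => h x (hJ hx)

theorem SolvesOn.congr (h : SolvesOn y I) (ho : IsOpen I) (hw : EqOn w y I) : SolvesOn w I := by
  intro x hx
  have hwy : w =ᶠ[𝓝 x] y := eventuallyEq_of_mem (ho.mem_nhds hx) hw
  rw [hw hx]
  exact ⟨(h x hx).1.congr_of_eventuallyEq hwy, (h x hx).2.congr_of_eventuallyEq hwy.deriv⟩

theorem SolvesOn.eqOn_of_phaseCurve_eq (ho : IsOpen I) (hI : IsPreconnected I)
    (hy : SolvesOn y I) (hw : SolvesOn w I) {τ : ℝ} (hτ : τ ∈ I)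
    (h : phaseCurve y τ = phaseCurve w τ) : EqOn y w I := fun _ ht =>
  congrArg Prod.fst <| eqOn_of_hasDerivAt_of_contDiff contDiff_phaseField ho hI
    (fun _ => hy.hasDerivAt_phaseCurve) (fun _ => hw.hasDerivAt_phaseCurve) hτ h ht

theorem snd_snd_eq_of_hasDerivAt_phaseField {α : ℝ → ℝ × ℝ × ℝ} {τ : ℝ} (ho : IsOpen I)
    (hI : IsPreconnected I) (hα : ∀ t ∈ I, HasDerivAt α (phaseField (α t)) t) (hτ : τ ∈ I)
    (h0 : (α τ).2.2 = τ) {t : ℝ} (ht : t ∈ I) : (α t).2.2 = t := by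
  have hderiv : ∀ s ∈ I, HasDerivAt (fun s => (α s).2.2 - s) 0 s := fun s hs => by
    have hsnd : HasDerivAt (fun s => (α s).2.2) 1 s := (hα s hs).snd.snd
    simpa using hsnd.fun_sub (hasDerivAt_id' s)
  have := ho.is_const_of_deriv_eq_zero hI
    (fun s hs => (hderiv s hs).differentiableAt.differentiableWithinAt)
    (fun s hs => (hderiv s hs).deriv) ht hτ
  simpa [h0, sub_eq_zero] using this

theorem solvesOn_fst_of_hasDerivAt_phaseField {α : ℝ → ℝ × ℝ × ℝ} {τ : ℝ} (ho : IsOpen I)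
    (hI : IsPreconnected I) (hα : ∀ t ∈ I, HasDerivAt α (phaseField (α t)) t) (hτ : τ ∈ I)
    (h0 : (α τ).2.2 = τ) : SolvesOn (fun t => (α t).1) I := by
  have hfst : ∀ t ∈ I, HasDerivAt (fun t => (α t).1) (α t).2.1 t := fun t ht => (hα t ht).fst
  intro t ht
  refine ⟨(hfst t ht).differentiableAt, ?_⟩
  have hsnd : HasDerivAt (fun t => (α t).2.1) (6 * (α t).1 ^ 2 - (α t).2.2) t :=
    (hα t ht).snd.fst
  rw [snd_snd_eq_of_hasDerivAt_phaseField ho hI hα hτ h0 ht] at hsnd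
  exact hsnd.congr_of_eventuallyEq <|
    eventually_of_mem (ho.mem_nhds ht) fun s hs => (hfst s hs).deriv

theorem exists_uniform_solvesOn {K : Set (ℝ × ℝ × ℝ)} (hK : IsCompact K) :
    ∃ ε > 0, ∀ p q τ : ℝ, (p, q, τ) ∈ K →
      ∃ w, SolvesOn w (Ioo (τ - ε) (τ + ε)) ∧ phaseCurve w τ = (p, q, τ) := by
  obtain ⟨ε, hε, H⟩ := exists_uniform_time_of_isCompact contDiff_phaseField hK
  refine ⟨ε, hε, fun p q τ hz => ?_⟩
  obtain ⟨α, h0, hα⟩ := H _ hz τ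
  have hτ : τ ∈ Ioo (τ - ε) (τ + ε) := ⟨by linarith, by linarith⟩
  refine ⟨fun t => (α t).1, solvesOn_fst_of_hasDerivAt_phaseField isOpen_Ioo isPreconnected_Ioo
    hα hτ (by rw [h0]), ?_⟩
  have hderiv : HasDerivAt (fun t => (α t).1) (α τ).2.1 τ := (hα τ hτ).fst
  simp [phaseCurve, hderiv.deriv, h0]

theorem IsSolution.subset_of_phaseCurve_eq (h : IsSolution y I) (hJo : IsOpen J)
    (hJ : IsPreconnected J) (hw : SolvesOn w J) {τ : ℝ} (hτI : τ ∈ I) (hτJ : τ ∈ J)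
    (heq : phaseCurve y τ = phaseCurve w τ) : J ⊆ I := by
  classical
  have hyw : EqOn y w (I ∩ J) :=
    SolvesOn.eqOn_of_phaseCurve_eq (h.isOpen.inter hJo)
      (h.isPreconnected.ordConnected.inter hJ.ordConnected).isPreconnected
      (h.solves.mono inter_subset_left) (hw.mono inter_subset_right) ⟨hτI, hτJ⟩ heq
  let z : ℝ → ℝ := I.piecewise y w
  have hzI : EqOn z y I := piecewise_eqOn I y w
  have hzJ : EqOn z w J := fun t ht => by
    by_cases htI : t ∈ I
    · rw [hzI htI, hyw ⟨htI, ht⟩]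
    · exact piecewise_eq_of_notMem I y w htI
  have hz : SolvesOn z (I ∪ J) := fun t ht =>
    ht.elim (h.solves.congr h.isOpen hzI t) (hw.congr hJo hzJ t)
  exact subset_union_right.trans <| h.maximal z (I ∪ J) (h.isOpen.union hJo)
    (h.isPreconnected.union τ hτI hτJ hJ) hz subset_union_left hzI

/-- The open intervals around `x` on which some solution with data `y x = p`, `y' x = q` lives. -/
def regularIntervals (x p q : ℝ) : Set (Set ℝ) :=
  {J | IsOpen J ∧ IsPreconnected J ∧ x ∈ J ∧ ∃ w, SolvesOn w J ∧ phaseCurve w x = (p, q, x)}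

theorem exists_solvesOn_sUnion_regularIntervals (x p q : ℝ) :
    ∃ y, SolvesOn y (⋃₀ regularIntervals x p q) ∧
      ∀ J ∈ regularIntervals x p q, ∀ w, SolvesOn w J → phaseCurve w x = (p, q, x) →
        EqOn y w J := by
  classical
  choose! w hw hdata using fun J (hJ : J ∈ regularIntervals x p q) => hJ.2.2.2
  choose! J hJ hmem using fun t (ht : t ∈ ⋃₀ regularIntervals x p q) => ht
  have agree : ∀ K ∈ regularIntervals x p q, ∀ z, SolvesOn z K → phaseCurve z x = (p, q, x) →
      EqOn (fun t => w (J t) t) z K := by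
    intro K hK z hz hzx t ht
    have htU : t ∈ ⋃₀ regularIntervals x p q := ⟨K, hK, ht⟩
    obtain ⟨hJo, hJc, hxJ, -⟩ := hJ t htU
    exact SolvesOn.eqOn_of_phaseCurve_eq (hJo.inter hK.1)
      (hJc.ordConnected.inter hK.2.1.ordConnected).isPreconnected
      ((hw _ (hJ t htU)).mono inter_subset_left) (hz.mono inter_subset_right) ⟨hxJ, hK.2.2.1⟩
      ((hdata _ (hJ t htU)).trans hzx.symm) ⟨hmem t htU, ht⟩
  refine ⟨fun t => w (J t) t, fun t ht => ?_, agree⟩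
  have hK := hJ t ht
  exact (hw _ hK).congr hK.1 (agree _ hK _ (hw _ hK) (hdata _ hK)) t (hmem t ht)

theorem exists_isSolution (x p q : ℝ) :
    ∃ y I, IsSolution y I ∧ x ∈ I ∧ phaseCurve y x = (p, q, x) := by
  obtain ⟨y, hy, hagree⟩ := exists_solvesOn_sUnion_regularIntervals x p q
  obtain ⟨ε, hε, H⟩ := exists_uniform_solvesOn (isCompact_singleton (x := (p, q, x)))
  obtain ⟨w, hw, hwx⟩ := H p q x rfl
  have hx : x ∈ Ioo (x - ε) (x + ε) := ⟨by linarith, by linarith⟩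
  have hJ : Ioo (x - ε) (x + ε) ∈ regularIntervals x p q :=
    ⟨isOpen_Ioo, isPreconnected_Ioo, hx, w, hw, hwx⟩
  have hyw : y =ᶠ[𝓝 x] w := eventuallyEq_of_mem (isOpen_Ioo.mem_nhds hx) (hagree _ hJ w hw hwx)
  have hyx : phaseCurve y x = (p, q, x) := by
    rw [← hwx, phaseCurve, phaseCurve, hyw.eq_of_nhds, hyw.deriv_eq]
  have hxU : x ∈ ⋃₀ regularIntervals x p q := ⟨_, hJ, hx⟩
  refine ⟨y, ⋃₀ regularIntervals x p q, ⟨isOpen_sUnion fun J hJ => hJ.1,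
    isPreconnected_sUnion x _ (fun J hJ => hJ.2.2.1) fun J hJ => hJ.2.1, hy, ?_⟩, hxU, hyx⟩
  intro z K hKo hK hz hIK hzy
  have hzyx : z =ᶠ[𝓝 x] y :=
    eventuallyEq_of_mem ((isOpen_sUnion fun J hJ => hJ.1).mem_nhds hxU) hzy
  refine subset_sUnion_of_mem ⟨hKo, hK, hIK hxU, z, hz, ?_⟩
  rw [← hyx, phaseCurve, phaseCurve, hzyx.eq_of_nhds, hzyx.deriv_eq]

theorem IsSolution.ordConnected (h : IsSolution y I) : I.OrdConnected :=
  h.isPreconnected.ordConnected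

theorem SolvesOn.exists_abs_deriv_le (h : SolvesOn y I) (hI : I.OrdConnected) {x₁ x₂ M : ℝ}
    (h1 : x₁ ∈ I) (hM : ∀ x ∈ I ∩ uIcc x₁ x₂, |y x| ≤ M) :
    ∃ M', ∀ x ∈ I ∩ uIcc x₁ x₂, |deriv y x| ≤ M' := by
  obtain ⟨B, hB⟩ := (isCompact_uIcc (a := x₁) (b := x₂)).isBounded.exists_norm_le
  have second_deriv_le : ∀ x ∈ I ∩ uIcc x₁ x₂, ‖6 * y x ^ 2 - x‖ ≤ 6 * M ^ 2 + B := by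
    intro x hx
    calc ‖6 * y x ^ 2 - x‖ ≤ ‖6 * y x ^ 2‖ + ‖x‖ := norm_sub_le _ _
      _ ≤ 6 * M ^ 2 + B := by
        rw [Real.norm_of_nonneg (by positivity), ← sq_abs (y x)]
        gcongr
        exacts [hM x hx, hB x hx.2]
  refine ⟨|deriv y x₁| + (6 * M ^ 2 + B) * |x₂ - x₁|, fun x hx => ?_⟩
  have hB0 : 0 ≤ B := (norm_nonneg x₁).trans (hB x₁ left_mem_uIcc)
  have increment_le : |deriv y x - deriv y x₁| ≤ (6 * M ^ 2 + B) * |x - x₁| :=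
    (hI.inter ordConnected_uIcc).convex.norm_image_sub_le_of_norm_hasDerivWithin_le
      (fun t ht => (h.hasDerivAt_deriv ht.1).hasDerivWithinAt) second_deriv_le
      ⟨h1, left_mem_uIcc⟩ hx
  calc |deriv y x| ≤ |deriv y x₁| + |deriv y x - deriv y x₁| := by
        linarith [abs_sub_abs_le_abs_sub (deriv y x) (deriv y x₁)]
    _ ≤ |deriv y x₁| + (6 * M ^ 2 + B) * |x₂ - x₁| := by
        grw [increment_le, abs_sub_left_of_mem_uIcc hx.2]

/-- Boundedness of `y` bounds `y'`, so the phase curve stays in a compact set and can be continued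
by a uniform amount from each of its points. -/
theorem IsSolution.mem_of_bounded (h : IsSolution y I) {x₁ x₂ M : ℝ} (h1 : x₁ ∈ I)
    (hM : ∀ x ∈ I ∩ uIcc x₁ x₂, |y x| ≤ M) : x₂ ∈ I := by
  obtain ⟨M', hM'⟩ := h.solves.exists_abs_deriv_le h.ordConnected h1 hM
  obtain ⟨ε, hε, H⟩ := exists_uniform_solvesOn
    ((isCompact_Icc (a := -M) (b := M)).prod
      ((isCompact_Icc (a := -M') (b := M')).prod (isCompact_uIcc (a := x₁) (b := x₂))))
  have mem_of_near : ∀ s ∈ uIcc x₁ x₂, ∀ t, |t - s| < ε → s ∈ I → t ∈ I := by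
    intro s hs t hts hsI
    obtain ⟨w, hw, hws⟩ := H (y s) (deriv y s) s
      ⟨abs_le.1 (hM s ⟨hsI, hs⟩), abs_le.1 (hM' s ⟨hsI, hs⟩), hs⟩
    refine h.subset_of_phaseCurve_eq isOpen_Ioo isPreconnected_Ioo hw hsI
      ⟨by linarith, by linarith⟩ hws.symm ?_
    rwa [← Real.ball_eq_Ioo, Metric.mem_ball, Real.dist_eq]
  refine (isPreconnected_uIcc.induction₂ (fun s t => s ∈ I ↔ t ∈ I) (fun s hs => ?_)
    (fun _ _ _ _ _ _ => Iff.trans) (fun _ _ _ _ => Iff.symm) left_mem_uIcc right_mem_uIcc).1 h1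
  filter_upwards [self_mem_nhdsWithin, mem_nhdsWithin_of_mem_nhds (Metric.ball_mem_nhds s hε)]
    with t ht hts
  rw [Metric.mem_ball, Real.dist_eq] at hts
  exact ⟨mem_of_near s hs t hts, mem_of_near t ht s (abs_sub_comm t s ▸ hts)⟩

end Solutions

/-! ### Blow-up times of the autonomous equation -/

theorem setIntegral_Ioi_pos {f : ℝ → ℝ} {a : ℝ} (hf : IntegrableOn f (Ioi a))
    (hpos : ∀ s ∈ Ioi a, 0 < f s) : 0 < ∫ s in Ioi a, f s := by
  rw [setIntegral_pos_iff_support_of_nonneg_ae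
    ((ae_restrict_mem measurableSet_Ioi).mono fun s hs => (hpos s hs).le) hf,
    inter_eq_right.2 fun s hs => Function.mem_support.2 (hpos s hs).ne']
  simp

/-- For `s = √(u - v)`, the energy identity of the motion `u'' = 6 u ^ 2 + c` that is at rest in
`v` reads `s' ^ 2 = quartic v c s`. -/
noncomputable def quartic (v c s : ℝ) : ℝ := s ^ 4 + 3 * v * s ^ 2 + 3 * v ^ 2 + c / 2

/-- The reciprocal of the speed of `s = √(u - v)` in the motion at rest in `v`. -/
noncomputable def slowness (v c s : ℝ) : ℝ := 1 / √(quartic v c s)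

/-- The time that the motion `u'' = 6 u ^ 2 + c` starting at rest in `v` takes to reach
`v + S ^ 2`. -/
noncomputable def travelTime (v c S : ℝ) : ℝ := ∫ s in (0 : ℝ)..S, slowness v c s

/-- The blow-up time of the motion `u'' = 6 u ^ 2 + c` starting at rest in `v`. -/
noncomputable def blowupTime (v c : ℝ) : ℝ := ∫ s in Ioi (0 : ℝ), slowness v c s

theorem integralI_eq_blowupTime (v : ℝ) : integralI v = blowupTime v 1 := rfl

section Slowness

variable {c : ℝ} (hc : 0 < c) (v s : ℝ)

theorem slowness_le_one_div {a : ℝ} (ha : 0 < a) (h : a ^ 2 ≤ quartic v c s) :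
    slowness v c s ≤ 1 / a :=
  one_div_le_one_div_of_le ha (Real.le_sqrt_of_sq_le h)

theorem pow_four_div_four_add_le_quartic (v c s : ℝ) : s ^ 4 / 4 + c / 2 ≤ quartic v c s := by
  have : quartic v c s = s ^ 4 / 4 + c / 2 + 3 * (v + s ^ 2 / 2) ^ 2 := by unfold quartic; ring
  linarith [sq_nonneg (v + s ^ 2 / 2)]

theorem sq_add_le_quartic (v c s : ℝ) : 3 / 4 * v ^ 2 + c / 2 ≤ quartic v c s := by
  have : quartic v c s = 3 / 4 * v ^ 2 + c / 2 + (s ^ 2 + 3 * v / 2) ^ 2 := by unfold quartic; ring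
  linarith [sq_nonneg (s ^ 2 + 3 * v / 2)]

include hc

theorem quartic_pos : 0 < quartic v c s := by
  linarith [sq_add_le_quartic v c s, sq_nonneg v]

theorem sqrt_quartic_pos : 0 < √(quartic v c s) := Real.sqrt_pos.2 (quartic_pos hc v s)

theorem slowness_pos : 0 < slowness v c s := one_div_pos.2 (sqrt_quartic_pos hc v s)

theorem continuous_uncurry_slowness :
    Continuous (Function.uncurry fun v s => slowness v c s) := by
  refine continuous_const.div ?_ fun z => (sqrt_quartic_pos hc z.1 z.2).ne'
  unfold quartic
  fun_prop

theorem continuous_slowness : Continuous (slowness v c) :=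
  (continuous_uncurry_slowness hc).uncurry_left v

theorem slowness_lt_of_lt {c' : ℝ} (h : c < c') : slowness v c' s < slowness v c s := by
  refine one_div_lt_one_div_of_lt (sqrt_quartic_pos hc v s)
    (Real.sqrt_lt_sqrt (quartic_pos hc v s).le ?_)
  unfold quartic
  linarith

theorem slowness_le_two_div_sq (hs : s ≠ 0) : slowness v c s ≤ 2 / s ^ 2 := by
  refine (slowness_le_one_div v s (a := s ^ 2 / 2) (by positivity) ?_).trans_eq (by field_simp)
  linarith [pow_four_div_four_add_le_quartic v c s, show (s ^ 2 / 2) ^ 2 = s ^ 4 / 4 by ring]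

theorem slowness_le_two_div_abs (hv : v ≠ 0) : slowness v c s ≤ 2 / |v| := by
  have := abs_pos.2 hv
  refine (slowness_le_one_div v s (a := |v| / 2) (by positivity) ?_).trans_eq (by field_simp)
  rw [div_pow, sq_abs]
  linarith [sq_add_le_quartic v c s, sq_nonneg v]

theorem exists_slowness_le :
    ∃ B, 0 < B ∧ ∀ v s, slowness v c s ≤ B * (1 + s ^ 2)⁻¹ := by
  obtain ⟨m, hm, hm8, hmc⟩ : ∃ m : ℝ, 0 < m ∧ m ≤ 1 / 8 ∧ m ≤ c / 4 :=
    ⟨min (1 / 8) (c / 4), by positivity, min_le_left _ _, min_le_right _ _⟩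
  refine ⟨1 / √m, by positivity, fun v s => ?_⟩
  refine (slowness_le_one_div v s (a := √m * (1 + s ^ 2)) (by positivity) ?_).trans_eq
    (by rw [← one_div_mul_one_div, one_div (1 + s ^ 2)])
  calc (√m * (1 + s ^ 2)) ^ 2 = m * (1 + s ^ 2) ^ 2 := by rw [mul_pow, Real.sq_sqrt hm.le]
    _ ≤ m * (2 * s ^ 4 + 2) := by gcongr; linarith [sq_nonneg (s ^ 2 - 1)]
    _ = m * (2 * s ^ 4) + 2 * m := by ring
    _ ≤ 1 / 8 * (2 * s ^ 4) + 2 * (c / 4) := by gcongr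
    _ = s ^ 4 / 4 + c / 2 := by ring
    _ ≤ quartic v c s := pow_four_div_four_add_le_quartic v c s

theorem integrable_slowness : Integrable (slowness v c) := by
  obtain ⟨B, -, hB⟩ := exists_slowness_le hc
  refine (integrable_inv_one_add_sq.const_mul B).mono'
    (continuous_slowness hc v).aestronglyMeasurable (ae_of_all _ fun s => ?_)
  rw [Real.norm_of_nonneg (slowness_pos hc v s).le]
  exact hB v s

theorem hasDerivAt_slowness :
    HasDerivAt (fun v => slowness v c s) (-(3 / 2 * (s ^ 2 + 2 * v) * slowness v c s ^ 3)) v := by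
  have hquartic : HasDerivAt (fun v => quartic v c s) (3 * (s ^ 2 + 2 * v)) v := by
    unfold quartic
    refine (((((hasDerivAt_id' v).const_mul 3).mul_const (s ^ 2)).const_add (s ^ 4)).fun_add
      (((hasDerivAt_id' v).fun_pow 2).const_mul 3)).add_const (c / 2) |>.congr_deriv ?_
    norm_num
    ring
  have hq := sqrt_quartic_pos hc v s
  simp only [slowness, one_div]
  refine ((hquartic.sqrt (quartic_pos hc v s).ne').fun_inv hq.ne').congr_deriv ?_
  field_simp

theorem exists_abs_deriv_slowness_le : ∃ A, ∀ v s,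
    |3 / 2 * (s ^ 2 + 2 * v) * slowness v c s ^ 3| ≤ A * slowness v c s := by
  refine ⟨3 + 7 / c, fun v s => ?_⟩
  have hq := quartic_pos hc v s
  have numerator_le : 3 / 2 * |s ^ 2 + 2 * v| ≤ (3 + 7 / c) * quartic v c s := by
    have h1 := pow_four_div_four_add_le_quartic v c s
    have h2 := sq_add_le_quartic v c s
    have h3 : 7 / 2 ≤ 7 / c * quartic v c s := by
      calc 7 / 2 = 7 / c * (c / 2) := by field_simp
        _ ≤ 7 / c * quartic v c s := by gcongr; linarith [sq_nonneg v]
    have h4 : |s ^ 2 + 2 * v| ≤ s ^ 2 + 2 * |v| :=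
      (abs_add_le _ _).trans_eq (by rw [abs_of_nonneg (sq_nonneg s), abs_mul, abs_two])
    linarith [sq_nonneg (s ^ 2 - 2), sq_nonneg (|v| - 4 / 3), sq_abs v,
      show (s ^ 2) ^ 2 = s ^ 4 by ring]
  have slowness_cube : slowness v c s ^ 3 = slowness v c s / quartic v c s := by
    rw [slowness, div_pow, pow_succ √_, Real.sq_sqrt hq.le]
    field_simp
  rw [slowness_cube, abs_mul, abs_mul, abs_of_pos (div_pos (slowness_pos hc v s) hq),
    abs_of_pos (by norm_num : (0 : ℝ) < 3 / 2), mul_div_assoc', div_le_iff₀ hq,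
    mul_right_comm (3 + 7 / c)]
  exact mul_le_mul_of_nonneg_right numerator_le (slowness_pos hc v s).le

end Slowness

section BlowupTime

variable {c : ℝ} (hc : 0 < c)

include hc

theorem blowupTime_pos (v : ℝ) : 0 < blowupTime v c :=
  setIntegral_Ioi_pos (integrable_slowness hc v).integrableOn fun s _ => slowness_pos hc v s

theorem tendsto_blowupTime_cocompact : Tendsto (fun v => blowupTime v c) (cocompact ℝ) (𝓝 0) := by
  obtain ⟨B, -, hB⟩ := exists_slowness_le hc
  have : (cocompact ℝ).IsCountablyGenerated := by
    rw [cocompact_eq_atBot_atTop]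
    infer_instance
  have norm_le (v s : ℝ) : ‖slowness v c s‖ ≤ B * (1 + s ^ 2)⁻¹ := by
    rw [Real.norm_of_nonneg (slowness_pos hc v s).le]
    exact hB v s
  have pointwise (s : ℝ) : Tendsto (fun v => slowness v c s) (cocompact ℝ) (𝓝 0) := by
    refine tendsto_of_tendsto_of_tendsto_of_le_of_le' tendsto_const_nhds
      ((tendsto_norm_cocompact_atTop (E := ℝ)).const_div_atTop 2)
      (.of_forall fun v => (slowness_pos hc v s).le) ?_
    filter_upwards [(tendsto_norm_cocompact_atTop (E := ℝ)).eventually_gt_atTop 0] with v hv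
    exact slowness_le_two_div_abs hc v s (norm_pos_iff.1 hv)
  simpa [blowupTime] using tendsto_integral_filter_of_dominated_convergence
    (μ := volume.restrict (Ioi (0 : ℝ))) (fun s => B * (1 + s ^ 2)⁻¹)
    (.of_forall fun v => (continuous_slowness hc v).aestronglyMeasurable)
    (.of_forall fun v => ae_of_all _ (norm_le v))
    (integrable_inv_one_add_sq.const_mul B).integrableOn (ae_of_all _ pointwise)

theorem integrable_and_hasDerivAt_blowupTime (v : ℝ) :
    IntegrableOn (fun s => 3 / 2 * (s ^ 2 + 2 * v) * slowness v c s ^ 3) (Ioi 0) ∧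
      HasDerivAt (fun v => blowupTime v c)
        (-∫ s in Ioi (0 : ℝ), 3 / 2 * (s ^ 2 + 2 * v) * slowness v c s ^ 3) v := by
  obtain ⟨B, -, hB⟩ := exists_slowness_le hc
  obtain ⟨A, hA⟩ := exists_abs_deriv_slowness_le hc
  have hA0 : 0 ≤ A := by
    by_contra! hneg
    linarith [hA 0 0, mul_neg_of_neg_of_pos hneg (slowness_pos hc 0 0),
      abs_nonneg (3 / 2 * ((0 : ℝ) ^ 2 + 2 * 0) * slowness 0 c 0 ^ 3)]
  have hcont : Continuous fun s => -(3 / 2 * (s ^ 2 + 2 * v) * slowness v c s ^ 3) := by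
    have := continuous_slowness hc v
    fun_prop
  obtain ⟨hint, hderiv⟩ := hasDerivAt_integral_of_dominated_loc_of_deriv_le
    (μ := volume.restrict (Ioi (0 : ℝ))) (F := fun v s => slowness v c s)
    (bound := fun s => A * (B * (1 + s ^ 2)⁻¹)) (univ_mem (f := 𝓝 v))
    (.of_forall fun v => (continuous_slowness hc v).aestronglyMeasurable)
    (integrable_slowness hc v).integrableOn hcont.aestronglyMeasurable
    (ae_of_all _ fun s v _ => by
      rw [norm_neg]
      exact (hA v s).trans (mul_le_mul_of_nonneg_left (hB v s) hA0))
    ((integrable_inv_one_add_sq.const_mul B).const_mul A).integrableOn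
    (ae_of_all _ fun s v _ => hasDerivAt_slowness hc v s)
  rw [integral_neg] at hderiv
  exact ⟨by simpa [IntegrableOn] using hint.neg, hderiv⟩

theorem continuous_blowupTime : Continuous fun v => blowupTime v c :=
  continuous_iff_continuousAt.2 fun v =>
    (integrable_and_hasDerivAt_blowupTime hc v).2.continuousAt

theorem deriv_blowupTime_neg {v : ℝ} (hv : 0 ≤ v) : deriv (fun v => blowupTime v c) v < 0 := by
  obtain ⟨hint, hderiv⟩ := integrable_and_hasDerivAt_blowupTime hc v
  rw [hderiv.deriv, neg_lt_zero]
  refine setIntegral_Ioi_pos hint fun s hs => ?_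
  have := slowness_pos hc v s
  have : 0 < s := hs
  positivity

theorem exists_neg_forall_blowupTime_le : ∃ v < 0, ∀ w, blowupTime w c ≤ blowupTime v c := by
  obtain ⟨v, hv⟩ := (continuous_blowupTime hc).exists_forall_ge' 0
    (((tendsto_blowupTime_cocompact hc).eventually_lt_const (blowupTime_pos hc 0)).mono
      fun _ h => h.le)
  refine ⟨v, ?_, hv⟩
  by_contra! hnonneg
  have : IsLocalMax (fun v => blowupTime v c) v := .of_forall hv
  exact (deriv_blowupTime_neg hc hnonneg).ne this.deriv_eq_zero

end BlowupTime

theorem isGreatest_C : IsGreatest (integralI '' Iio 0) C := by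
  obtain ⟨v, hv, hmax⟩ := exists_neg_forall_blowupTime_le one_pos
  have : IsGreatest (integralI '' Iio 0) (integralI v) :=
    ⟨⟨v, hv, rfl⟩, by rintro _ ⟨w, _, rfl⟩; exact hmax w⟩
  rwa [C, this.csSup_eq]

theorem blowupTime_one_le_C (v : ℝ) : blowupTime v 1 ≤ C := by
  obtain ⟨w, hw, hmax⟩ := exists_neg_forall_blowupTime_le one_pos
  exact (hmax v).trans (isGreatest_C.2 ⟨w, hw, rfl⟩)

theorem C_pos : 0 < C := (blowupTime_pos one_pos 0).trans_le (blowupTime_one_le_C 0)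

section Scaling

variable {h : ℝ} (hh : 0 < h) (v : ℝ)

include hh

theorem slowness_pow_four_mul (s : ℝ) :
    slowness v (h ^ 4) (h * s) = 1 / h ^ 2 * slowness (v / h ^ 2) 1 s := by
  have : quartic v (h ^ 4) (h * s) = (h ^ 2) ^ 2 * quartic (v / h ^ 2) 1 s := by
    unfold quartic
    field_simp
  rw [slowness, this, Real.sqrt_mul (by positivity), Real.sqrt_sq (by positivity), slowness,
    one_div_mul_one_div]

theorem blowupTime_pow_four : blowupTime v (h ^ 4) = blowupTime (v / h ^ 2) 1 / h := by
  have hsubst := integral_comp_mul_left_Ioi (slowness v (h ^ 4)) 0 hh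
  simp_rw [slowness_pow_four_mul hh] at hsubst
  rw [integral_const_mul, mul_zero, smul_eq_mul] at hsubst
  change 1 / h ^ 2 * blowupTime _ 1 = h⁻¹ * blowupTime v (h ^ 4) at hsubst
  field_simp at hsubst ⊢
  linarith

theorem blowupTime_pow_four_le : blowupTime v (h ^ 4) ≤ C / h := by
  rw [blowupTime_pow_four hh]
  exact div_le_div_of_nonneg_right (blowupTime_one_le_C _) hh.le

theorem exists_blowupTime_pow_four_eq : ∃ v, blowupTime v (h ^ 4) = C / h := by
  obtain ⟨v, -, hv⟩ := isGreatest_C.1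
  refine ⟨v * h ^ 2, ?_⟩
  rw [blowupTime_pow_four hh, mul_div_cancel_right₀ _ (by positivity), ← hv,
    integralI_eq_blowupTime]

end Scaling

section TravelTime

@[simp]
theorem travelTime_zero (v c : ℝ) : travelTime v c 0 = 0 := intervalIntegral.integral_same

variable {c c' : ℝ} (hc : 0 < c) (h : c < c') (v S : ℝ)

include hc

theorem hasDerivAt_travelTime : HasDerivAt (travelTime v c) (slowness v c S) S :=
  ((continuous_slowness hc v).integral_hasStrictDerivAt 0 S).hasDerivAt

theorem strictMono_travelTime : StrictMono (travelTime v c) :=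
  strictMono_of_hasDerivAt_pos (hasDerivAt_travelTime hc v) (slowness_pos hc v)

theorem tendsto_travelTime : Tendsto (travelTime v c) atTop (𝓝 (blowupTime v c)) :=
  intervalIntegral_tendsto_integral_Ioi 0 (integrable_slowness hc v).integrableOn tendsto_id

theorem travelTime_le_blowupTime : travelTime v c S ≤ blowupTime v c :=
  (strictMono_travelTime hc v).monotone.ge_of_tendsto (tendsto_travelTime hc v) S

include h in
theorem strictMono_travelTime_sub : StrictMono fun S => travelTime v c S - travelTime v c' S :=
  strictMono_of_hasDerivAt_pos
    (fun S => (hasDerivAt_travelTime hc v S).fun_sub (hasDerivAt_travelTime (hc.trans h) v S))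
    fun S => sub_pos.2 (slowness_lt_of_lt hc v S h)

include h in
theorem travelTime_sub_le_blowupTime_sub :
    travelTime v c S - travelTime v c' S ≤ blowupTime v c - blowupTime v c' :=
  (strictMono_travelTime_sub hc h v).monotone.ge_of_tendsto
    ((tendsto_travelTime hc v).sub (tendsto_travelTime (hc.trans h) v)) S

theorem continuous_travelTime_left : Continuous fun v => travelTime v c S :=
  intervalIntegral.continuous_parametric_intervalIntegral_of_continuous'
    (continuous_uncurry_slowness hc) 0 S

theorem blowupTime_sub_travelTime_le (hS : 0 < S) :
    blowupTime v c - travelTime v c S ≤ 2 / S := by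
  have hint := integrable_slowness hc v
  have split : travelTime v c S + ∫ s in Ioi S, slowness v c s = blowupTime v c :=
    intervalIntegral.integral_interval_add_Ioi hint.integrableOn hint.integrableOn
  have tail : ∫ s in Ioi S, slowness v c s ≤ ∫ s in Ioi S, 2 * s ^ (-2 : ℝ) := by
    refine setIntegral_mono_on hint.integrableOn
      ((integrableOn_Ioi_rpow_of_lt (by norm_num) hS).const_mul 2) measurableSet_Ioi fun s hs => ?_
    have hs0 : 0 < s := hS.trans hs
    rw [Real.rpow_neg hs0.le, Real.rpow_two, ← div_eq_mul_inv]
    exact slowness_le_two_div_sq hc v s hs0.ne'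
  rw [integral_const_mul, integral_Ioi_rpow_of_lt (by norm_num) hS] at tail
  norm_num [Real.rpow_neg_one] at tail
  rw [div_eq_mul_inv]
  linarith

include h in
/-- Raising the coefficient to `c'` while `s` runs through a fixed interval shortens the blow-up
time by an amount that does not depend on the initial value, because blow-up times tend to `0` for
large initial values. -/
theorem exists_uniform_gain {S₁ S₂ D : ℝ} (hS : S₁ < S₂) (hD : ∀ v, blowupTime v c ≤ D) :
    ∃ ε > 0, ∀ v, blowupTime v c - ((travelTime v c S₂ - travelTime v c' S₂) -
      (travelTime v c S₁ - travelTime v c' S₁)) ≤ D - ε := by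
  let G : ℝ → ℝ := fun v => blowupTime v c - ((travelTime v c S₂ - travelTime v c' S₂) -
    (travelTime v c S₁ - travelTime v c' S₁))
  have hDpos : 0 < D := (blowupTime_pos hc 0).trans_le (hD 0)
  have G_lt : ∀ v, G v < blowupTime v c := fun v =>
    sub_lt_self _ (sub_pos.2 (strictMono_travelTime_sub hc h v hS))
  have continuous_G : Continuous G := by
    have := continuous_blowupTime hc
    have := continuous_travelTime_left hc
    have := continuous_travelTime_left (hc.trans h)
    fun_prop
  have eventually_le : ∀ᶠ v in cocompact ℝ, max (G v) (D / 2) ≤ max (G 0) (D / 2) := by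
    filter_upwards [(tendsto_blowupTime_cocompact hc).eventually_lt_const (half_pos hDpos)]
      with v hv
    rw [max_eq_right ((G_lt v).trans hv).le]
    exact le_max_right _ _
  obtain ⟨v₀, hv₀⟩ :=
    (continuous_G.max (continuous_const (y := D / 2))).exists_forall_ge' 0 eventually_le
  have max_lt_D : max (G v₀) (D / 2) < D :=
    max_lt ((G_lt v₀).trans_le (hD v₀)) (half_lt_self hDpos)
  refine ⟨D - max (G v₀) (D / 2), sub_pos.2 max_lt_D, fun v => ?_⟩
  rw [sub_sub_cancel]
  exact (le_max_left _ _).trans (hv₀ v)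

end TravelTime

/-! ### Motions with a variable coefficient -/

theorem monotoneOn_Icc_of_hasDerivAt {f f' : ℝ → ℝ} {a b : ℝ}
    (hf : ∀ x ∈ Icc a b, HasDerivAt f (f' x) x) (hf' : ∀ x ∈ Ioo a b, 0 ≤ f' x) :
    MonotoneOn f (Icc a b) :=
  monotoneOn_of_hasDerivWithinAt_nonneg (convex_Icc a b) (HasDerivAt.continuousOn hf)
    (fun x hx => (hf x (interior_subset hx)).hasDerivWithinAt) (by rwa [interior_Icc])

theorem strictMonoOn_Icc_of_hasDerivAt {f f' : ℝ → ℝ} {a b : ℝ}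
    (hf : ∀ x ∈ Icc a b, HasDerivAt f (f' x) x) (hf' : ∀ x ∈ Ioo a b, 0 < f' x) :
    StrictMonoOn f (Icc a b) :=
  strictMonoOn_of_hasDerivWithinAt_pos (convex_Icc a b) (HasDerivAt.continuousOn hf)
    (fun x hx => (hf x (interior_subset hx)).hasDerivWithinAt) (by rwa [interior_Icc])

/-- The squared velocity at the position `x` of the motion `u'' = 6 u ^ 2 + c` at rest in `v`. -/
def sqVelocity (v c x : ℝ) : ℝ := 4 * (x ^ 3 - v ^ 3) + 2 * c * (x - v)

theorem sqVelocity_mono {v c c' x : ℝ} (hx : v ≤ x) (hc : c ≤ c') :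
    sqVelocity v c x ≤ sqVelocity v c' x := by
  have := sub_nonneg.2 hx
  unfold sqVelocity
  gcongr

section Travel

variable {u p : ℝ → ℝ} {v c : ℝ} (hc : 0 < c)

theorem sqVelocity_eq_quartic {x : ℝ} (h : v ≤ x) :
    sqVelocity v c x = (2 * √(x - v)) ^ 2 * quartic v c √(x - v) := by
  have hs := Real.sq_sqrt (sub_nonneg.2 h)
  rw [sqVelocity, quartic, mul_pow, show √(x - v) ^ 4 = (√(x - v) ^ 2) ^ 2 by ring, hs]
  ring

include hc

theorem sqrt_sqVelocity_pos {x : ℝ} (h : v < x) : 0 < √(sqVelocity v c x) := by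
  have := Real.sqrt_pos.2 (sub_pos.2 h)
  have := quartic_pos hc v √(x - v)
  rw [sqVelocity_eq_quartic h.le]
  positivity

theorem hasDerivAt_travelTime_sqrt {σ : ℝ} (hu : HasDerivAt u (p σ) σ) (hv : v < u σ) :
    HasDerivAt (fun σ => travelTime v c √(u σ - v)) (p σ / √(sqVelocity v c (u σ))) σ := by
  refine ((hasDerivAt_travelTime hc v √(u σ - v)).comp σ
    ((hu.sub_const v).sqrt (sub_pos.2 hv).ne')).congr_deriv ?_
  rw [sqVelocity_eq_quartic hv.le, Real.sqrt_mul (sq_nonneg _), Real.sqrt_sq (by positivity),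
    slowness, div_mul_div_comm, one_mul, mul_comm √(quartic _ _ _)]

variable {α β : ℝ}

theorem continuousOn_travelTime_sqrt (hu : ∀ σ ∈ Icc α β, HasDerivAt u (p σ) σ) :
    ContinuousOn (fun σ => travelTime v c √(u σ - v)) (Icc α β) := by
  have : Continuous (travelTime v c) :=
    continuous_iff_continuousAt.2 fun S => (hasDerivAt_travelTime hc v S).continuousAt
  exact this.comp_continuousOn ((HasDerivAt.continuousOn hu).sub continuousOn_const).sqrt

variable (hu : ∀ σ ∈ Icc α β, HasDerivAt u (p σ) σ) (hv : ∀ σ ∈ Ioo α β, v < u σ)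

include hu hv

theorem sub_le_travelTime_sub (hαβ : α ≤ β)
    (hp : ∀ σ ∈ Ioo α β, √(sqVelocity v c (u σ)) ≤ p σ) :
    β - α ≤ travelTime v c √(u β - v) - travelTime v c √(u α - v) := by
  have : MonotoneOn (fun σ => travelTime v c √(u σ - v) - σ) (Icc α β) := by
    refine monotoneOn_of_hasDerivWithinAt_nonneg
      (f' := fun σ => p σ / √(sqVelocity v c (u σ)) - 1) (convex_Icc α β)
      ((continuousOn_travelTime_sqrt hc hu).sub continuousOn_id) ?_ ?_ <;>
      rw [interior_Icc] <;> intro σ hσ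
    · exact ((hasDerivAt_travelTime_sqrt hc (hu σ (Ioo_subset_Icc_self hσ))
        (hv σ hσ)).fun_sub (hasDerivAt_id' σ)).hasDerivWithinAt
    · exact sub_nonneg.2 ((one_le_div (sqrt_sqVelocity_pos hc (hv σ hσ))).2 (hp σ hσ))
  linarith [this (left_mem_Icc.2 hαβ) (right_mem_Icc.2 hαβ) hαβ]

theorem travelTime_sub_lt_sub (hαβ : α < β)
    (hp : ∀ σ ∈ Ioo α β, p σ < √(sqVelocity v c (u σ))) :
    travelTime v c √(u β - v) - travelTime v c √(u α - v) < β - α := by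
  have : StrictMonoOn (fun σ => σ - travelTime v c √(u σ - v)) (Icc α β) := by
    refine strictMonoOn_of_hasDerivWithinAt_pos
      (f' := fun σ => 1 - p σ / √(sqVelocity v c (u σ))) (convex_Icc α β)
      (continuousOn_id.sub (continuousOn_travelTime_sqrt hc hu)) ?_ ?_ <;>
      rw [interior_Icc] <;> intro σ hσ
    · exact ((hasDerivAt_id' σ).fun_sub (hasDerivAt_travelTime_sqrt hc
        (hu σ (Ioo_subset_Icc_self hσ)) (hv σ hσ))).hasDerivWithinAt
    · exact sub_pos.2 ((div_lt_one (sqrt_sqVelocity_pos hc (hv σ hσ))).2 (hp σ hσ))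
  linarith [this (left_mem_Icc.2 hαβ.le) (right_mem_Icc.2 hαβ.le) hαβ]

end Travel

/-- `u` moves by `u'' = 6 u ^ 2 + k` during the time `[0, L]`, with velocity `p`, which is
initially nonnegative, and with a coefficient `k` that is positive inside. -/
structure Motion (u p k : ℝ → ℝ) (L : ℝ) : Prop where
  hasDerivAt_position : ∀ σ ∈ Icc 0 L, HasDerivAt u (p σ) σ
  hasDerivAt_velocity : ∀ σ ∈ Icc 0 L, HasDerivAt p (6 * u σ ^ 2 + k σ) σ
  coeff_pos : ∀ σ ∈ Ioo 0 L, 0 < k σ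
  velocity_zero_nonneg : 0 ≤ p 0

namespace Motion

variable {u p k : ℝ → ℝ} {L σ : ℝ}

theorem strictMonoOn_velocity (h : Motion u p k L) : StrictMonoOn p (Icc 0 L) :=
  strictMonoOn_Icc_of_hasDerivAt h.hasDerivAt_velocity fun σ hσ => by
    have := h.coeff_pos σ hσ
    positivity

theorem velocity_pos (h : Motion u p k L) (hσ : σ ∈ Ioc 0 L) : 0 < p σ :=
  h.velocity_zero_nonneg.trans_lt (h.strictMonoOn_velocity (left_mem_Icc.2 (hσ.1.le.trans hσ.2))
    (Ioc_subset_Icc_self hσ) hσ.1)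

theorem strictMonoOn_position (h : Motion u p k L) : StrictMonoOn u (Icc 0 L) :=
  strictMonoOn_Icc_of_hasDerivAt h.hasDerivAt_position fun _ hσ =>
    h.velocity_pos (Ioo_subset_Ioc_self hσ)

theorem lt_position (h : Motion u p k L) (hσ : σ ∈ Ioc 0 L) : u 0 < u σ :=
  h.strictMonoOn_position (left_mem_Icc.2 (hσ.1.le.trans hσ.2)) (Ioc_subset_Icc_self hσ) hσ.1

theorem hasDerivAt_sqVelocity (h : Motion u p k L) (hσ : σ ∈ Icc 0 L) {κ : ℝ → ℝ} {κ' : ℝ}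
    (hκ : HasDerivAt κ κ' σ) :
    HasDerivAt (fun σ => p σ ^ 2 - sqVelocity (u 0) (κ σ) (u σ))
      (2 * ((k σ - κ σ) * p σ - κ' * (u σ - u 0))) σ := by
  have hu := h.hasDerivAt_position σ hσ
  unfold sqVelocity
  refine (((h.hasDerivAt_velocity σ hσ).fun_pow 2).fun_sub
    ((((hu.fun_pow 3).sub_const (u 0 ^ 3)).const_mul 4).fun_add
      ((hκ.const_mul 2).fun_mul (hu.sub_const (u 0))))).congr_deriv ?_
  norm_num
  ring

/-- The hypothesis is the condition for `p ^ 2 - sqVelocity (u 0) (κ σ) (u σ)` to increase. -/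
theorem sqVelocity_le (h : Motion u p k L) {κ κ' : ℝ → ℝ}
    (hκ : ∀ σ ∈ Icc 0 L, HasDerivAt κ (κ' σ) σ)
    (hκ' : ∀ σ ∈ Ioo 0 L, κ' σ * (u σ - u 0) ≤ (k σ - κ σ) * p σ) (hσ : σ ∈ Icc 0 L) :
    sqVelocity (u 0) (κ σ) (u σ) ≤ p σ ^ 2 := by
  have := monotoneOn_Icc_of_hasDerivAt (fun τ hτ => h.hasDerivAt_sqVelocity hτ (hκ τ hτ))
    (fun τ hτ => mul_nonneg zero_le_two (sub_nonneg.2 (hκ' τ hτ)))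
    (left_mem_Icc.2 (hσ.1.trans hσ.2)) hσ hσ.1
  simp only [sqVelocity, sub_self, mul_zero, add_zero, sub_zero] at this ⊢
  linarith [sq_nonneg (p 0)]

theorem sq_lt_sqVelocity (h : Motion u p k L) {c : ℝ} (h0 : p 0 = 0)
    (hk : ∀ σ ∈ Ioo 0 L, k σ < c) (hσ : σ ∈ Ioc 0 L) :
    p σ ^ 2 < sqVelocity (u 0) c (u σ) := by
  have := strictMonoOn_Icc_of_hasDerivAt
    (fun τ hτ => (h.hasDerivAt_sqVelocity hτ (hasDerivAt_const τ c)).fun_neg)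
    (fun τ hτ => by
      have := mul_pos (sub_pos.2 (hk τ hτ)) (h.velocity_pos (Ioo_subset_Ioc_self hτ))
      linarith)
    (left_mem_Icc.2 (hσ.1.le.trans hσ.2)) (Ioc_subset_Icc_self hσ) hσ.1
  simp only [sqVelocity, sub_self, mul_zero, add_zero, sub_zero, h0] at this ⊢
  linarith

theorem sub_le_travelTime_sub (h : Motion u p k L) {c α β : ℝ} (hc : 0 < c) (hα : 0 ≤ α)
    (hαβ : α ≤ β) (hβ : β ≤ L) (hE : ∀ σ ∈ Ioo α β, sqVelocity (u 0) c (u σ) ≤ p σ ^ 2) :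
    β - α ≤ travelTime (u 0) c √(u β - u 0) - travelTime (u 0) c √(u α - u 0) := by
  have mem_Ioc {σ : ℝ} (hσ : σ ∈ Ioo α β) : σ ∈ Ioc 0 L := ⟨hα.trans_lt hσ.1, hσ.2.le.trans hβ⟩
  exact PainleveOne.sub_le_travelTime_sub hc
    (fun σ hσ => h.hasDerivAt_position σ ⟨hα.trans hσ.1, hσ.2.trans hβ⟩)
    (fun σ hσ => h.lt_position (mem_Ioc hσ)) hαβ
    fun σ hσ => Real.sqrt_le_iff.2 ⟨(h.velocity_pos (mem_Ioc hσ)).le, hE σ hσ⟩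

theorem travelTime_sub_lt_sub (h : Motion u p k L) {c α β : ℝ} (hc : 0 < c) (h0 : p 0 = 0)
    (hk : ∀ σ ∈ Ioo 0 L, k σ < c) (hα : 0 ≤ α) (hαβ : α < β) (hβ : β ≤ L) :
    travelTime (u 0) c √(u β - u 0) - travelTime (u 0) c √(u α - u 0) < β - α := by
  have mem_Ioc {σ : ℝ} (hσ : σ ∈ Ioo α β) : σ ∈ Ioc 0 L := ⟨hα.trans_lt hσ.1, hσ.2.le.trans hβ⟩
  exact PainleveOne.travelTime_sub_lt_sub hc
    (fun σ hσ => h.hasDerivAt_position σ ⟨hα.trans hσ.1, hσ.2.trans hβ⟩)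
    (fun σ hσ => h.lt_position (mem_Ioc hσ)) hαβ
    fun σ hσ => Real.lt_sqrt_of_sq_lt (h.sq_lt_sqVelocity h0 hk (mem_Ioc hσ))

theorem lifetime_split (h : Motion u p k L) {κ : ℝ → ℝ} {c₁ c₂ δ : ℝ} (hc₁ : 0 < c₁) (hc₂ : 0 < c₂)
    (hδ : δ ∈ Icc 0 L) (hE : ∀ σ ∈ Icc 0 L, sqVelocity (u 0) (κ σ) (u σ) ≤ p σ ^ 2)
    (h₁ : ∀ σ ∈ Icc 0 δ, c₁ ≤ κ σ) (h₂ : ∀ σ ∈ Icc δ L, c₂ ≤ κ σ) :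
    δ ≤ travelTime (u 0) c₁ √(u δ - u 0) ∧
      L - δ ≤ blowupTime (u 0) c₂ - travelTime (u 0) c₂ √(u δ - u 0) := by
  have sqVelocity_le {c σ : ℝ} (hσ : σ ∈ Ioc 0 L) (hc : c ≤ κ σ) :
      sqVelocity (u 0) c (u σ) ≤ p σ ^ 2 :=
    (sqVelocity_mono (h.lt_position hσ).le hc).trans (hE σ (Ioc_subset_Icc_self hσ))
  constructor
  · simpa using h.sub_le_travelTime_sub hc₁ le_rfl hδ.1 hδ.2 fun σ hσ =>
      sqVelocity_le ⟨hσ.1, hσ.2.le.trans hδ.2⟩ (h₁ σ (Ioo_subset_Icc_self hσ))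
  · refine (h.sub_le_travelTime_sub hc₂ hδ.1 hδ.2 le_rfl fun σ hσ =>
      sqVelocity_le ⟨hδ.1.trans_lt hσ.1, hσ.2.le⟩ (h₂ σ (Ioo_subset_Icc_self hσ))).trans ?_
    gcongr
    exact travelTime_le_blowupTime hc₂ _ _

theorem position_sub_le (h : Motion u p k L) (hσ : σ ∈ Icc 0 L) : u σ - u 0 ≤ σ * p σ := by
  have : MonotoneOn (fun τ => τ * p σ - u τ) (Icc 0 σ) := by
    refine monotoneOn_Icc_of_hasDerivAt (f' := fun τ => 1 * p σ - p τ)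
      (fun τ hτ => ((hasDerivAt_id' τ).mul_const (p σ)).fun_sub
        (h.hasDerivAt_position τ ⟨hτ.1, hτ.2.trans hσ.2⟩)) fun τ hτ => ?_
    rw [one_mul, sub_nonneg]
    exact h.strictMonoOn_velocity.monotoneOn ⟨hτ.1.le, hτ.2.le.trans hσ.2⟩ hσ hτ.2.le
  linarith [this (left_mem_Icc.2 hσ.1) (right_mem_Icc.2 hσ.1) hσ.1]

theorem le_position_sub (h : Motion u p k L) {c : ℝ} (hk : ∀ σ ∈ Ioo 0 L, c ≤ k σ)
    (hσ : σ ∈ Icc 0 L) : c / 2 * σ ^ 2 ≤ u σ - u 0 := by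
  have zero_mem : (0 : ℝ) ∈ Icc 0 L := left_mem_Icc.2 (hσ.1.trans hσ.2)
  have velocity_sub : MonotoneOn (fun τ => p τ - τ * c) (Icc 0 L) :=
    monotoneOn_Icc_of_hasDerivAt
      (fun τ hτ => (h.hasDerivAt_velocity τ hτ).fun_sub ((hasDerivAt_id' τ).mul_const c))
      fun τ hτ => by linarith [hk τ hτ, sq_nonneg (u τ)]
  have position_sub : MonotoneOn (fun τ => u τ - τ ^ 2 * (c / 2)) (Icc 0 L) := by
    refine monotoneOn_Icc_of_hasDerivAt
      (fun τ hτ => (h.hasDerivAt_position τ hτ).fun_sub ((hasDerivAt_pow 2 τ).mul_const (c / 2)))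
      fun τ hτ => ?_
    norm_num
    linarith [velocity_sub zero_mem (Ioo_subset_Icc_self hτ) hτ.1.le, h.velocity_zero_nonneg]
  linarith [position_sub zero_mem hσ hσ.1]

/-- By the time `D / 2` the position has either left a fixed neighbourhood of `u 0`, and blows up
soon, or the larger coefficient acts on a fixed remaining stretch. -/
theorem exists_lifetime_le_of_add_le {c D : ℝ} (hc : 0 < c) (hD : ∀ v, blowupTime v c ≤ D) :
    ∃ ε > 0, ∀ {u p k : ℝ → ℝ} {L : ℝ}, Motion u p k L → (∀ σ ∈ Ioo 0 L, c + σ ≤ k σ) →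
      L ≤ D - ε := by
  have hDpos : 0 < D := (blowupTime_pos hc 0).trans_le (hD 0)
  have hc' : c < c + D / 4 := by linarith
  obtain ⟨ε, hε, gain⟩ := exists_uniform_gain hc hc' (lt_add_one (8 / D)) hD
  refine ⟨min ε (D / 4), by positivity, fun {u p k L} h hk => ?_⟩
  rcases le_or_gt L (D / 2) with hL | hL
  · linarith [min_le_right ε (D / 4)]
  have energy : ∀ σ ∈ Icc 0 L, sqVelocity (u 0) (c + σ / 2) (u σ) ≤ p σ ^ 2 := fun σ hσ =>
    h.sqVelocity_le (fun τ _ => ((hasDerivAt_id' τ).div_const 2).const_add c) (fun τ hτ => by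
      have := mul_le_mul_of_nonneg_right (hk τ hτ) (h.velocity_pos (Ioo_subset_Ioc_self hτ)).le
      linarith [h.position_sub_le (Ioo_subset_Icc_self hτ)]) hσ
  obtain ⟨first, second⟩ := h.lifetime_split hc (hc.trans hc') (δ := D / 2)
    ⟨by positivity, hL.le⟩ energy (fun σ hσ => by linarith [hσ.1]) fun σ hσ => by linarith [hσ.1]
  set S := √(u (D / 2) - u 0)
  rcases le_or_gt (8 / D) S with hS | hS
  · have hS0 : 0 < 8 / D := by positivity
    have : 2 / S ≤ D / 4 := (div_le_div_of_nonneg_left zero_le_two hS0 hS).trans_eq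
      (by field_simp; norm_num)
    linarith [blowupTime_sub_travelTime_le (hc.trans hc') (u 0) S (hS0.trans_le hS),
      min_le_right ε (D / 4)]
  · linarith [(strictMono_travelTime_sub hc hc' (u 0)).monotone hS.le, gain (u 0),
      travelTime_sub_le_blowupTime_sub hc hc' (u 0) (8 / D + 1), min_le_left ε (D / 4)]

/-- The time is gained at the start: the coefficient is well above `c` while the motion leaves
`u 0`. -/
theorem exists_lifetime_le_of_add_sub_le {c D : ℝ} (hc : 0 < c) (hD : ∀ v, blowupTime v c ≤ D) :
    ∃ ε > 0, ∀ {u p k : ℝ → ℝ} {L : ℝ}, Motion u p k L → (∀ σ ∈ Ioo 0 L, c + (L - σ) ≤ k σ) →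
      L ≤ D - ε := by
  have hDpos : 0 < D := (blowupTime_pos hc 0).trans_le (hD 0)
  have hc' : c < c + D / 4 := by linarith
  have hS : 0 < √(c / 2 * (D / 4) ^ 2) := by positivity
  obtain ⟨ε, hε, gain⟩ := exists_uniform_gain hc hc' hS hD
  refine ⟨min ε (D / 2), by positivity, fun {u p k L} h hk => ?_⟩
  rcases le_or_gt L (D / 2) with hL | hL
  · linarith [min_le_right ε (D / 2)]
  have hδ : L - D / 4 ∈ Icc 0 L := ⟨by linarith, by linarith⟩
  have energy : ∀ σ ∈ Icc 0 L, sqVelocity (u 0) (c + (L - σ)) (u σ) ≤ p σ ^ 2 := fun σ hσ =>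
    h.sqVelocity_le (fun τ _ => ((hasDerivAt_id' τ).const_sub L).const_add c) (fun τ hτ => by
      have := mul_nonneg (sub_nonneg.2 (hk τ hτ)) (h.velocity_pos (Ioo_subset_Ioc_self hτ)).le
      linarith [h.lt_position (Ioo_subset_Ioc_self hτ)]) hσ
  obtain ⟨first, second⟩ := h.lifetime_split (hc.trans hc') hc hδ energy
    (fun σ hσ => by linarith [hσ.2]) fun σ hσ => by linarith [hσ.2]
  have le_sqrt : √(c / 2 * (D / 4) ^ 2) ≤ √(u (L - D / 4) - u 0) := by
    refine Real.sqrt_le_sqrt (le_trans ?_ (h.le_position_sub (c := c)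
      (fun σ hσ => by linarith [hk σ hσ, hσ.2]) hδ))
    gcongr
    linarith
  have gain_zero := gain (u 0)
  simp only [travelTime_zero, sub_zero] at gain_zero
  linarith [(strictMono_travelTime_sub hc hc' (u 0)).monotone le_sqrt, min_le_left ε (D / 2)]

/-- A motion that starts at rest with a coefficient below `c` falls behind the motion with the
coefficient `c` by a positive time, so that it stays bounded up to the blow-up time of the
latter. -/
theorem exists_abs_position_le {c δ : ℝ} (hc : 0 < c) (hδ : 0 < δ) (hδT : δ ≤ blowupTime (u 0) c)
    (h0 : p 0 = 0) (hk : ∀ σ ∈ Ioo 0 (blowupTime (u 0) c), k σ < c) (h : Motion u p k δ) :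
    ∃ M, ∀ L ∈ Icc 0 (blowupTime (u 0) c), Motion u p k L → |u L| ≤ M := by
  have gap : travelTime (u 0) c √(u δ - u 0) < δ := by
    simpa using h.travelTime_sub_lt_sub hc h0 (fun σ hσ => hk σ ⟨hσ.1, hσ.2.trans_le hδT⟩)
      le_rfl hδ le_rfl
  obtain ⟨R, hR⟩ := ((tendsto_travelTime hc (u 0)).eventually_const_lt
    (show blowupTime (u 0) c - (δ - travelTime (u 0) c √(u δ - u 0)) < blowupTime (u 0) c by
      linarith)).exists
  refine ⟨|u 0| + R ^ 2, fun L hL hmotion => ?_⟩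
  have u_zero_le : u 0 ≤ u L := hmotion.strictMonoOn_position.monotoneOn (left_mem_Icc.2 hL.1)
    (right_mem_Icc.2 hL.1) hL.1
  have sqrt_lt : √(u L - u 0) < R := by
    refine (strictMono_travelTime hc (u 0)).lt_iff_lt.1 (lt_of_le_of_lt ?_ hR)
    rcases le_or_gt L δ with hLδ | hLδ
    · have : u L ≤ u δ :=
        h.strictMonoOn_position.monotoneOn ⟨hL.1, hLδ⟩ (right_mem_Icc.2 hδ.le) hLδ
      refine ((strictMono_travelTime hc (u 0)).monotone
        (Real.sqrt_le_sqrt (sub_le_sub_right this (u 0)))).trans ?_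
      linarith
    · linarith [hL.2, hmotion.travelTime_sub_lt_sub hc h0
        (fun σ hσ => hk σ ⟨hσ.1, hσ.2.trans_le hL.2⟩) hδ.le hLδ le_rfl]
  have position_lt := (Real.sqrt_lt' ((Real.sqrt_nonneg _).trans_lt sqrt_lt)).1 sqrt_lt
  rw [abs_le]
  constructor <;> linarith [neg_abs_le (u 0), le_abs_self (u 0), sq_nonneg R]

end Motion

/-! ### Solutions as motions -/

section Solutions

variable {y : ℝ → ℝ} {I : Set ℝ} {x₀ x₁ e : ℝ}

theorem IsSolution.motion (h : IsSolution y I) (he : e = 1 ∨ e = -1) {L : ℝ} (hI₁ : x₁ ∈ I)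
    (h₁ : x₁ ≤ 0) (hI₂ : x₁ + e * L ∈ I) (h₂ : x₁ + e * L ≤ 0) (hd : 0 ≤ e * deriv y x₁) :
    Motion (fun σ => y (x₁ + e * σ)) (fun σ => e * deriv y (x₁ + e * σ))
      (fun σ => -(x₁ + e * σ)) L := by
  have he2 : e * e = 1 := by rcases he with rfl | rfl <;> norm_num
  have mem_I {σ : ℝ} (hσ : σ ∈ Icc 0 L) : x₁ + e * σ ∈ I := by
    refine h.ordConnected.uIcc_subset hI₁ hI₂ ?_
    rcases he with rfl | rfl
    · exact mem_uIcc_of_le (by linarith [hσ.1]) (by linarith [hσ.2])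
    · exact mem_uIcc_of_ge (by linarith [hσ.2]) (by linarith [hσ.1])
  have hline (σ : ℝ) : HasDerivAt (fun σ => x₁ + e * σ) e σ := by
    simpa using ((hasDerivAt_id' σ).const_mul e).const_add x₁
  refine ⟨fun σ hσ => ?_, fun σ hσ => ?_, fun σ hσ => ?_, by simpa using hd⟩
  · exact ((h.solves.hasDerivAt (mem_I hσ)).comp σ (hline σ)).congr_deriv (mul_comm _ _)
  · refine (((h.solves.hasDerivAt_deriv (mem_I hσ)).comp σ (hline σ)).const_mul e).congr_deriv ?_
    linear_combination (6 * y (x₁ + e * σ) ^ 2 - (x₁ + e * σ)) * he2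
  · rcases he with rfl | rfl <;> linarith [hσ.1, hσ.2]

theorem IsSolution.exists_add_mul_mem (h : IsSolution y I) (hx₁ : x₁ ∈ I) (e : ℝ) {T : ℝ}
    (hT : 0 < T) : ∃ δ ∈ Ioc 0 T, x₁ + e * δ ∈ I := by
  have hcont : Continuous fun δ => x₁ + e * δ := by fun_prop
  have hmem : ∀ᶠ δ in 𝓝[>] (0 : ℝ), x₁ + e * δ ∈ I :=
    (hcont.tendsto 0).eventually_mem (by simpa using h.isOpen.mem_nhds hx₁)
      |>.filter_mono nhdsWithin_le_nhds
  exact (Filter.Eventually.and (Ioc_mem_nhdsGT hT) hmem).exists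

/-- As long as `-x ≤ c`, a solution at rest in `x₁` lags behind the autonomous motion with
coefficient `c`, in both directions. -/
theorem IsSolution.add_mul_blowupTime_mem (h : IsSolution y I) (he : e = 1 ∨ e = -1) {c : ℝ}
    (hc : 0 < c) (hI : x₁ ∈ I) (h₁ : x₁ ∈ Icc (-c) 0)
    (h₂ : x₁ + e * blowupTime (y x₁) c ∈ Icc (-c) 0) (hd : deriv y x₁ = 0) :
    x₁ + e * blowupTime (y x₁) c ∈ I := by
  set T := blowupTime (y x₁) c
  have hT0 : 0 < T := blowupTime_pos hc _
  have mem_Icc {σ : ℝ} (hσ : σ ∈ Icc 0 T) : x₁ + e * σ ≤ 0 := by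
    rcases he with rfl | rfl <;> linarith [hσ.1, hσ.2, h₁.2, h₂.2]
  have hmotion {L : ℝ} (hL : L ∈ Icc 0 T) (hLI : x₁ + e * L ∈ I) :=
    h.motion he hI h₁.2 hLI (mem_Icc hL) (by simp [hd])
  obtain ⟨δ, hδ, hδI⟩ := h.exists_add_mul_mem hI e hT0
  obtain ⟨M, hM⟩ := (hmotion (Ioc_subset_Icc_self hδ) hδI).exists_abs_position_le hc hδ.1
    (by simpa using hδ.2) (by simp [hd]) (fun σ hσ => by
      simp only [mul_zero, add_zero] at hσ
      rcases he with rfl | rfl <;> linarith [hσ.1, hσ.2, h₁.1, h₂.1])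
  simp only [mul_zero, add_zero] at hM
  refine h.mem_of_bounded (M := M) hI fun x hx => ?_
  obtain ⟨σ, hσ, rfl⟩ : ∃ σ ∈ Icc 0 T, x = x₁ + e * σ := by
    have hx' := hx.2
    rcases he with rfl | rfl
    · rw [uIcc_of_le (by linarith)] at hx'
      exact ⟨x - x₁, ⟨by linarith [hx'.1], by linarith [hx'.2]⟩, by ring⟩
    · rw [uIcc_of_ge (by linarith)] at hx'
      exact ⟨x₁ - x, ⟨by linarith [hx'.2], by linarith [hx'.1]⟩, by ring⟩
  exact hM σ hσ (hmotion hσ hx.1)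

theorem IsSolution.monotoneOn_deriv (h : IsSolution y I) : MonotoneOn (deriv y) (I ∩ Iic 0) := by
  refine monotoneOn_of_hasDerivWithinAt_nonneg (f' := fun x => 6 * y x ^ 2 - x)
    (h.ordConnected.inter ordConnected_Iic).convex
    (HasDerivAt.continuousOn fun x hx => h.solves.hasDerivAt_deriv hx.1)
    (fun x hx => (h.solves.hasDerivAt_deriv (interior_subset hx).1).hasDerivWithinAt) fun x hx => ?_
  have := mem_Iic.1 (interior_subset hx).2
  nlinarith [sq_nonneg (y x)]

theorem IsSolution.convexOn (h : IsSolution y I) : ConvexOn ℝ (I ∩ Iic 0) y :=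
  (h.monotoneOn_deriv.mono interior_subset).convexOn_of_deriv
    (h.ordConnected.inter ordConnected_Iic).convex
    (HasDerivAt.continuousOn fun _ hx => h.solves.hasDerivAt hx.1)
    fun _ hx =>
      (h.solves.hasDerivAt (interior_subset hx).1).differentiableAt.differentiableWithinAt

theorem IsSolution.isMinOn_of_deriv_eq_zero (h : IsSolution y I) {m : ℝ} (hm : m ∈ I)
    (hm0 : m < 0) (hd : deriv y m = 0) : IsMinOn y (I ∩ Iic 0) m := by
  refine h.convexOn.isMinOn_of_rightDeriv_eq_zero ?_ ?_
  · rw [mem_interior_iff_mem_nhds]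
    exact inter_mem (h.isOpen.mem_nhds hm) (Iic_mem_nhds hm0)
  · rw [(h.solves.hasDerivAt hm).hasDerivWithinAt.derivWithin (uniqueDiffWithinAt_Ioi m), hd]

theorem IsSolution.deriv_eq_zero_of_isMinOn (h : IsSolution y I) {m : ℝ} (hm : m ∈ I)
    (hmx : m < x₀) (hmin : IsMinOn y (I ∩ Iic x₀) m) : deriv y m = 0 :=
  (hmin.isLocalMin (inter_mem (h.isOpen.mem_nhds hm) (Iic_mem_nhds hmx))).deriv_eq_zero

theorem IsSolution.exists_deriv_eq_zero_of_deriv_nonpos (h : IsSolution y I) {x : ℝ}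
    (hx : x ∈ I) (hx₁ : x₁ ∈ I) (hxx₁ : x ≤ x₁) (hdx : deriv y x ≤ 0) (hd : 0 < deriv y x₁) :
    ∃ m ∈ I, m < x₁ ∧ deriv y m = 0 := by
  have hsub : Icc x x₁ ⊆ I := h.ordConnected.out hx hx₁
  obtain ⟨m, hm, hm0⟩ := intermediate_value_Ico hxx₁
    (HasDerivAt.continuousOn fun t ht => h.solves.hasDerivAt_deriv (hsub ht)) ⟨hdx, hd⟩
  exact ⟨m, hsub (Ico_subset_Icc_self hm), hm.2, hm0⟩

/-- An increasing convex function lies between its tangent and a constant, hence stays bounded. -/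
theorem IsSolution.Iic_subset_of_deriv_nonneg (h : IsSolution y I) (hx₁ : x₁ ∈ I) (h₁ : x₁ ≤ 0)
    (hd : ∀ x ∈ I, x ≤ x₁ → 0 ≤ deriv y x) : Iic x₁ ⊆ I := by
  intro x₂ hx₂
  have hx₂ : x₂ ≤ x₁ := hx₂
  refine h.mem_of_bounded (M := |y x₁| + deriv y x₁ * (x₁ - x₂)) hx₁ fun x hx => ?_
  obtain ⟨hxI, hx⟩ := hx
  rw [uIcc_of_ge hx₂] at hx
  have hsub : Icc x x₁ ⊆ I := h.ordConnected.out hxI hx₁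
  have le_right : y x ≤ y x₁ :=
    monotoneOn_Icc_of_hasDerivAt (fun t ht => h.solves.hasDerivAt (hsub ht))
      (fun t ht => hd t (hsub (Ioo_subset_Icc_self ht)) ht.2.le)
      (left_mem_Icc.2 hx.2) (right_mem_Icc.2 hx.2) hx.2
  have tangent_le : deriv y x₁ * x - y x ≤ deriv y x₁ * x₁ - y x₁ :=
    monotoneOn_Icc_of_hasDerivAt (f := fun t => deriv y x₁ * t - y t)
      (f' := fun t => deriv y x₁ * 1 - deriv y t)
      (fun t ht => ((hasDerivAt_id' t).const_mul _).fun_sub (h.solves.hasDerivAt (hsub ht)))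
      (fun t ht => by
        rw [mul_one, sub_nonneg]
        exact h.monotoneOn_deriv ⟨hsub (Ioo_subset_Icc_self ht), ht.2.le.trans h₁⟩ ⟨hx₁, h₁⟩
          ht.2.le)
      (left_mem_Icc.2 hx.2) (right_mem_Icc.2 hx.2) hx.2
  have hgap : deriv y x₁ * (x₁ - x) ≤ deriv y x₁ * (x₁ - x₂) :=
    mul_le_mul_of_nonneg_left (by linarith [hx.1]) (hd x₁ hx₁ le_rfl)
  have : 0 ≤ deriv y x₁ * (x₁ - x₂) := mul_nonneg (hd x₁ hx₁ le_rfl) (by linarith)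
  exact abs_le.2 ⟨by linarith [neg_abs_le (y x₁)], by linarith [le_abs_self (y x₁)]⟩

/-- Since `y'' ≥ -x`, the slope would drop to zero by the time `x² / 2` has grown by `y' x₁`. -/
theorem IsSolution.exists_deriv_eq_zero (h : IsSolution y I) (hx₁ : x₁ ∈ I) (h₁ : x₁ ≤ 0)
    (hd : 0 < deriv y x₁) : ∃ m ∈ I, m < x₁ ∧ deriv y m = 0 := by
  by_contra hcrit
  have deriv_pos : ∀ x ∈ I, x ≤ x₁ → 0 < deriv y x := fun x hx hxx₁ => by
    by_contra! hdx
    exact hcrit (h.exists_deriv_eq_zero_of_deriv_nonpos hx hx₁ hxx₁ hdx hd)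
  have hsub := h.Iic_subset_of_deriv_nonneg hx₁ h₁ fun x hx hxx₁ => (deriv_pos x hx hxx₁).le
  set x₂ := -√(x₁ ^ 2 + 2 * deriv y x₁)
  have hx₂ : x₂ ^ 2 = x₁ ^ 2 + 2 * deriv y x₁ := by
    rw [neg_sq, Real.sq_sqrt (by positivity)]
  have hle : x₂ ≤ x₁ :=
    neg_le.1 ((neg_le_abs x₁).trans (Real.abs_le_sqrt (by linarith)))
  have slope_drop : deriv y x₂ + x₂ ^ 2 / 2 ≤ deriv y x₁ + x₁ ^ 2 / 2 :=
    monotoneOn_Icc_of_hasDerivAt (f := fun x => deriv y x + x ^ 2 / 2)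
      (f' := fun x => 6 * y x ^ 2)
      (fun x hx => ((h.solves.hasDerivAt_deriv (hsub hx.2)).fun_add
        ((hasDerivAt_pow 2 x).div_const 2)).congr_deriv (by norm_num))
      (fun x _ => by positivity) (left_mem_Icc.2 hle) (right_mem_Icc.2 hle) hle
  linarith [deriv_pos x₂ (hsub hle) hle]

theorem IsSolution.leftEnd_lt (h : IsSolution y I) (hx₁ : x₁ ∈ I) : leftEnd I < x₁ := by
  obtain ⟨δ, hδ, hδI⟩ := h.exists_add_mul_mem hx₁ (-1) one_pos
  refine (iInf₂_le _ hδI).trans_lt (EReal.coe_lt_coe_iff.2 ?_)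
  linarith [hδ.1]

theorem coe_le_leftEnd (hx₁ : x₁ ∈ I) {r : ℝ} (h : ∀ x ∈ I, x ≤ x₁ → r ≤ x) :
    (r : EReal) ≤ leftEnd I :=
  le_iInf₂ fun x hx => EReal.coe_le_coe_iff.2 <|
    (le_total x x₁).elim (h x hx) (h x₁ hx₁ le_rfl).trans

end Solutions

/-! ### Bounds for the extremal endpoints -/

section ExtremalEndpoints

variable {x₀ r : ℝ}

theorem extXminus_lt (x₀ : ℝ) : extXminus x₀ < x₀ := by
  obtain ⟨y, I, h, hI, hdata⟩ := exists_isSolution x₀ 0 0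
  have hd : deriv y x₀ = 0 := congrArg (fun z => z.2.1) hdata
  calc extXminus x₀ ≤ leftEnd I := sInf_le ⟨y, I, h, hI, hd.le, rfl⟩
    _ < x₀ := h.leftEnd_lt hI

theorem extXminus_le_leftEnd {y : ℝ → ℝ} {I : Set ℝ} (h : IsSolution y I) (hx₀ : x₀ ∈ I)
    (hr : r ≤ x₀) (hd : r ∈ I → deriv y r ≤ 0) : extXminus r ≤ leftEnd I := by
  by_cases hrI : r ∈ I
  · exact sInf_le ⟨y, I, h, hrI, hd hrI, rfl⟩
  · refine (extXminus_lt r).le.trans (coe_le_leftEnd hx₀ fun x hx _ => ?_)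
    by_contra! hxr
    exact hrI (h.ordConnected.out hx hx₀ ⟨hxr.le, hr⟩)

theorem monotoneOn_extXminus : MonotoneOn extXminus (Iic 0) := by
  intro r hr x₀ hx₀ hle
  refine le_sInf ?_
  rintro _ ⟨y, I, h, hI, hd, rfl⟩
  exact extXminus_le_leftEnd h hI hle fun hrI =>
    (h.monotoneOn_deriv ⟨hrI, hr⟩ ⟨hI, hx₀⟩ hle).trans hd

theorem extXmin_le_of_deriv_eq_zero {y : ℝ → ℝ} {I : Set ℝ} (h : IsSolution y I) (hI : x₀ ∈ I)
    (hx₀ : x₀ ≤ 0) {m : ℝ} (hm : m ∈ I) (hmx : m < x₀) (hd : deriv y m = 0) :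
    extXmin x₀ ≤ m := by
  have hm0 : m < 0 := hmx.trans_le hx₀
  refine sInf_le ⟨y, I, m, h, hI, ?_, hm, hmx, ?_, rfl⟩
  · exact hd.ge.trans (h.monotoneOn_deriv ⟨hm, hm0.le⟩ ⟨hI, hx₀⟩ hmx.le)
  · exact (h.isMinOn_of_deriv_eq_zero hm hm0 hd).on_subset
      (inter_subset_inter_right I (Iic_subset_Iic.2 hx₀))

theorem min_le_extXmin (hx₀ : x₀ ≤ 0) (hr : r ≤ x₀) : min (r : EReal) (extXmin r) ≤ extXmin x₀ := by
  refine le_sInf ?_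
  rintro _ ⟨y, I, m, h, hI, -, hm, hmx, hmin, rfl⟩
  rcases le_or_gt r m with hrm | hmr
  · exact (min_le_left _ _).trans (EReal.coe_le_coe_iff.2 hrm)
  · exact (min_le_right _ _).trans <|
      extXmin_le_of_deriv_eq_zero h (h.ordConnected.out hm hI ⟨hmr.le, hr⟩) (hr.trans hx₀) hm hmr
        (h.deriv_eq_zero_of_isMinOn hm hmx hmin)

theorem extXminus_le_extX (hx₀ : x₀ ≤ 0) (hr : extXmin x₀ = r) (hrx : r < x₀) :
    extXminus r ≤ extX x₀ := by
  refine le_sInf ?_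
  rintro _ ⟨y, I, h, hI, rfl⟩
  refine extXminus_le_leftEnd h hI hrx.le fun hrI => ?_
  by_contra! hd
  obtain ⟨m, hm, hmr, hd0⟩ := h.exists_deriv_eq_zero hrI (hrx.le.trans hx₀) hd
  refine (EReal.coe_lt_coe_iff.2 hmr).not_ge ?_
  exact hr ▸ extXmin_le_of_deriv_eq_zero h hI hx₀ hm (hmr.trans hrx) hd0

variable {h : ℝ} (hh : 0 < h)

include hh

theorem exists_coe_le_extXminus :
    ∃ ε > 0, ((-h ^ 4 - C / h + ε : ℝ) : EReal) ≤ extXminus (-h ^ 4) := by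
  have hc : 0 < h ^ 4 := pow_pos hh 4
  obtain ⟨ε, hε, H⟩ := Motion.exists_lifetime_le_of_add_le hc (blowupTime_pow_four_le hh)
  refine ⟨ε, hε, le_sInf ?_⟩
  rintro _ ⟨y, I, hy, hI, hd, rfl⟩
  refine coe_le_leftEnd hI fun x hx hxx₀ => ?_
  have hend : -h ^ 4 + -1 * (-h ^ 4 - x) = x := by ring
  have := H (hy.motion (L := -h ^ 4 - x) (.inr rfl) hI (by linarith) (by rwa [hend])
    (by linarith) (by linarith)) fun σ _ => by linarith
  linarith

theorem exists_coe_le_extXmin :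
    ∃ ε > 0, ((-h ^ 4 - C / h + ε : ℝ) : EReal) ≤ extXmin (-h ^ 4) := by
  have hc : 0 < h ^ 4 := pow_pos hh 4
  obtain ⟨ε, hε, H⟩ := Motion.exists_lifetime_le_of_add_sub_le hc (blowupTime_pow_four_le hh)
  refine ⟨ε, hε, le_sInf ?_⟩
  rintro _ ⟨y, I, m, hy, hI, -, hm, hmx, hmin, rfl⟩
  have hd := hy.deriv_eq_zero_of_isMinOn hm hmx hmin
  have hend : m + 1 * (-h ^ 4 - m) = -h ^ 4 := by ring
  have := H (hy.motion (L := -h ^ 4 - m) (.inl rfl) hm (by linarith) (by rwa [hend])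
    (by linarith) (by simp [hd])) fun σ _ => by linarith
  exact EReal.coe_le_coe_iff.2 (by linarith)

theorem extXmin_le_neg_pow_four (hle : C / h ≤ h ^ 4) :
    extXmin (-h ^ 4 + C / h) ≤ ((-h ^ 4 : ℝ) : EReal) := by
  have hc : 0 < h ^ 4 := pow_pos hh 4
  have hC : 0 < C / h := div_pos C_pos hh
  obtain ⟨v, hv⟩ := exists_blowupTime_pow_four_eq hh
  obtain ⟨y, I, hy, hI, hdata⟩ := exists_isSolution (-h ^ 4) v 0
  simp only [phaseCurve, Prod.mk.injEq, and_true] at hdata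
  obtain ⟨rfl, hd⟩ := hdata
  have hend := hy.add_mul_blowupTime_mem (.inl rfl) hc hI ⟨le_rfl, by linarith⟩
    (by rw [hv]; constructor <;> linarith) hd
  rw [hv, one_mul] at hend
  exact extXmin_le_of_deriv_eq_zero hy hend (by linarith) hI (by linarith) hd

theorem extX_lt_neg_pow_four (hle : 2 * (C / h) ≤ h ^ 4) :
    extX (-h ^ 4 + 2 * (C / h)) < ((-h ^ 4 : ℝ) : EReal) := by
  have hc : 0 < h ^ 4 := pow_pos hh 4
  have hC : 0 < C / h := div_pos C_pos hh
  obtain ⟨v, hv⟩ := exists_blowupTime_pow_four_eq hh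
  obtain ⟨y, I, hy, hI, hdata⟩ := exists_isSolution (-h ^ 4 + C / h) v 0
  simp only [phaseCurve, Prod.mk.injEq, and_true] at hdata
  obtain ⟨rfl, hd⟩ := hdata
  have hend {e : ℝ} (he : e = 1 ∨ e = -1) : -h ^ 4 + C / h + e * (C / h) ∈ I := by
    have := hy.add_mul_blowupTime_mem he hc hI ⟨by linarith, by linarith⟩ (by
      rw [hv]
      rcases he with rfl | rfl <;> constructor <;> linarith) hd
    rwa [hv] at this
  have hright := hend (.inl rfl)
  have hleft := hend (.inr rfl)
  rw [show -h ^ 4 + C / h + 1 * (C / h) = -h ^ 4 + 2 * (C / h) by ring] at hright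
  rw [show -h ^ 4 + C / h + -1 * (C / h) = -h ^ 4 by ring] at hleft
  calc extX (-h ^ 4 + 2 * (C / h)) ≤ leftEnd I := sInf_le ⟨y, I, hy, hright, rfl⟩
    _ < _ := hy.leftEnd_lt hleft

end ExtremalEndpoints

/-! ### The root `eta` -/

section Eta

variable {x₀ : ℝ}

theorem mem_etaRoots_iff {h : ℝ} : h ∈ etaRoots x₀ ↔ 0 < h ∧ h ^ 4 - C / h = |x₀| := by
  refine and_congr_right fun hh => ?_
  field_simp
  constructor <;> intro <;> linarith

theorem etaRoots_nonempty (x₀ : ℝ) : (etaRoots x₀).Nonempty := by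
  have hC := C_pos
  have hN : 1 ≤ 1 + |x₀| + C := by linarith [abs_nonneg x₀]
  have hup : C ≤ (1 + |x₀| + C) ^ 5 - |x₀| * (1 + |x₀| + C) := by
    calc C ≤ (1 + |x₀| + C) * (1 + |x₀| + C - |x₀|) := by nlinarith [abs_nonneg x₀]
      _ ≤ (1 + |x₀| + C) * ((1 + |x₀| + C) ^ 4 - |x₀|) := by
        gcongr
        exact le_self_pow₀ hN four_ne_zero
      _ = _ := by ring
  obtain ⟨h, ⟨hh, -⟩, hroot⟩ := intermediate_value_Icc (f := fun h => h ^ 5 - |x₀| * h)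
    (zero_le_one.trans hN) (by fun_prop) ⟨by simpa using hC.le, hup⟩
  refine ⟨h, hh.lt_of_ne ?_, hroot⟩
  rintro rfl
  exact hC.ne (by simpa using hroot)

theorem etaRoots_subsingleton (x₀ : ℝ) : (etaRoots x₀).Subsingleton := by
  have hmono : StrictMonoOn (fun h => h ^ 4 - C / h) (Ioi 0) := fun a ha b _ hab =>
    sub_lt_sub (pow_lt_pow_left₀ hab (le_of_lt ha) four_ne_zero)
      (div_lt_div_of_pos_left C_pos ha hab)
  intro a ha b hb
  rw [mem_etaRoots_iff] at ha hb
  exact hmono.injOn ha.1 hb.1 (ha.2.trans hb.2.symm)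

theorem etaRoots_eq (x₀ : ℝ) : etaRoots x₀ = {eta x₀} := by
  obtain ⟨h, hh⟩ := etaRoots_nonempty x₀
  rw [eta, (etaRoots_subsingleton x₀).eq_singleton_of_mem hh, csSup_singleton]

theorem eta_mem_etaRoots (x₀ : ℝ) : eta x₀ ∈ etaRoots x₀ :=
  etaRoots_eq x₀ ▸ mem_singleton _

theorem eta_pos (x₀ : ℝ) : 0 < eta x₀ := (eta_mem_etaRoots x₀).1

theorem eta_pow_four_sub (x₀ : ℝ) : eta x₀ ^ 4 - C / eta x₀ = |x₀| :=
  (mem_etaRoots_iff.1 (eta_mem_etaRoots x₀)).2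

theorem abs_lt_eta_pow_four (x₀ : ℝ) : |x₀| < eta x₀ ^ 4 := by
  linarith [eta_pow_four_sub x₀, div_pos C_pos (eta_pos x₀)]

end Eta

/-! ### Finiteness and explicit bounds -/

section Finiteness

variable {x₀ : ℝ}

theorem pow_four_rpow {h : ℝ} (hh : 0 ≤ h) : (h ^ 4) ^ (1 / 4 : ℝ) = h := by
  simpa using Real.pow_rpow_inv_natCast hh four_ne_zero

theorem abs_neg_pow_four (h : ℝ) : |-h ^ 4| = h ^ 4 := by
  rw [abs_neg, abs_of_nonneg (by positivity)]

theorem abs_neg_pow_four_rpow {h : ℝ} (hh : 0 ≤ h) : |-h ^ 4| ^ (1 / 4 : ℝ) = h := by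
  rw [abs_neg_pow_four, pow_four_rpow hh]

theorem exists_eq_neg_pow_four (hx₀ : x₀ < 0) : ∃ h > 0, x₀ = -h ^ 4 := by
  refine ⟨|x₀| ^ (1 / 4 : ℝ), Real.rpow_pos_of_pos (abs_pos.2 hx₀.ne) _, ?_⟩
  rw [← Real.rpow_natCast, ← Real.rpow_mul (abs_nonneg x₀)]
  norm_num [abs_of_neg hx₀]

theorem extXminus_ne_bot (hx₀ : x₀ ≤ 0) : extXminus x₀ ≠ ⊥ := by
  have hlt : x₀ - 1 < 0 := by linarith
  obtain ⟨h, hh, hx⟩ := exists_eq_neg_pow_four hlt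
  obtain ⟨ε, -, hε⟩ := exists_coe_le_extXminus hh
  refine ne_bot_of_le_ne_bot (EReal.coe_ne_bot _) (hε.trans ?_)
  exact hx ▸ monotoneOn_extXminus hlt.le hx₀ (by linarith)

theorem extXmin_ne_bot (hx₀ : x₀ ≤ 0) : extXmin x₀ ≠ ⊥ := by
  obtain ⟨h, hh, hx⟩ := exists_eq_neg_pow_four (show x₀ - 1 < 0 by linarith)
  obtain ⟨ε, -, hε⟩ := exists_coe_le_extXmin hh
  have hmin : min ((x₀ - 1 : ℝ) : EReal) (extXmin (x₀ - 1)) ≤ extXmin x₀ :=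
    min_le_extXmin hx₀ (by linarith)
  refine ne_bot_of_gt (lt_of_lt_of_le (lt_min (EReal.bot_lt_coe _) ?_) hmin)
  exact hx ▸ (EReal.bot_lt_coe _).trans_le hε

theorem extXminus_eq (hx₀ : x₀ ≤ 0) : extXminus x₀ = (Xminus x₀ : EReal) :=
  (EReal.coe_toReal (extXminus_lt x₀).ne_top (extXminus_ne_bot hx₀)).symm

theorem extXmin_le_neg_eta_pow_four (hx₀ : x₀ ≤ 0) :
    extXmin x₀ ≤ ((-eta x₀ ^ 4 : ℝ) : EReal) := by
  have hη := eta_pow_four_sub x₀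
  have hle := extXmin_le_neg_pow_four (eta_pos x₀) (by linarith [abs_nonneg x₀])
  rw [abs_of_nonpos hx₀] at hη
  rwa [show -eta x₀ ^ 4 + C / eta x₀ = x₀ by linarith] at hle

theorem extXmin_eq (hx₀ : x₀ ≤ 0) : extXmin x₀ = (Xmin x₀ : EReal) :=
  (EReal.coe_toReal (ne_top_of_le_ne_top (EReal.coe_ne_top _) (extXmin_le_neg_eta_pow_four hx₀))
    (extXmin_ne_bot hx₀)).symm

theorem Xmin_le_neg_eta_pow_four (hx₀ : x₀ ≤ 0) : Xmin x₀ ≤ -eta x₀ ^ 4 := by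
  simpa only [extXmin_eq hx₀, EReal.coe_le_coe_iff] using extXmin_le_neg_eta_pow_four hx₀

theorem Xmin_lt (hx₀ : x₀ ≤ 0) : Xmin x₀ < x₀ := by
  linarith [Xmin_le_neg_eta_pow_four hx₀, abs_lt_eta_pow_four x₀, neg_abs_le x₀]

theorem lt_Xmin (hx₀ : x₀ < 0) : x₀ - C / |x₀| ^ (1 / 4 : ℝ) < Xmin x₀ := by
  obtain ⟨h, hh, rfl⟩ := exists_eq_neg_pow_four hx₀
  obtain ⟨ε, hε, hle⟩ := exists_coe_le_extXmin hh
  rw [extXmin_eq hx₀.le, EReal.coe_le_coe_iff] at hle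
  rw [abs_neg_pow_four_rpow hh.le]
  linarith

theorem lt_Xminus (hx₀ : x₀ < 0) : x₀ - C / |x₀| ^ (1 / 4 : ℝ) < Xminus x₀ := by
  obtain ⟨h, hh, rfl⟩ := exists_eq_neg_pow_four hx₀
  obtain ⟨ε, hε, hle⟩ := exists_coe_le_extXminus hh
  rw [extXminus_eq hx₀.le, EReal.coe_le_coe_iff] at hle
  rw [abs_neg_pow_four_rpow hh.le]
  linarith

theorem coe_Xminus_Xmin_le (hx₀ : x₀ ≤ 0) : (Xminus (Xmin x₀) : EReal) ≤ extX x₀ := by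
  have hlt := Xmin_lt hx₀
  rw [← extXminus_eq (hlt.le.trans hx₀)]
  exact extXminus_le_extX hx₀ (extXmin_eq hx₀) hlt

theorem exists_two_rpow_eq_pow_four :
    ∃ q : ℝ, 0 < q ∧ (2 : ℝ) ^ (4 / 5 : ℝ) = q ^ 4 ∧ q ^ 5 = 2 := by
  refine ⟨2 ^ (1 / 5 : ℝ), by positivity, ?_, ?_⟩ <;>
  · rw [← Real.rpow_natCast, ← Real.rpow_mul zero_le_two]
    norm_num

theorem extX_lt_sub_div_eta (hx₀ : x₀ ≤ 0) : extX x₀ <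
    ((x₀ - (2 : ℝ) ^ (4 / 5 : ℝ) * C / eta (x₀ / (2 : ℝ) ^ (4 / 5 : ℝ)) : ℝ) : EReal) := by
  obtain ⟨q, hq, hq4, hq5⟩ := exists_two_rpow_eq_pow_four
  rw [hq4]
  have hη := eta_pow_four_sub (x₀ / q ^ 4)
  have hpos := eta_pos (x₀ / q ^ 4)
  set η := eta (x₀ / q ^ 4)
  have hdiv : 2 * (C / (q * η)) = q ^ 4 * C / η := by
    rw [← hq5]
    field_simp
  have hx : (q * η) ^ 4 - 2 * (C / (q * η)) = -x₀ :=
    calc (q * η) ^ 4 - 2 * (C / (q * η)) = q ^ 4 * (η ^ 4 - C / η) := by rw [hdiv]; ring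
      _ = -x₀ := by
        rw [hη, abs_div, abs_of_nonpos hx₀, abs_of_pos (pow_pos hq 4)]
        field_simp
  have hlt := extX_lt_neg_pow_four (mul_pos hq hpos) (by linarith)
  rwa [show -(q * η) ^ 4 + 2 * (C / (q * η)) = x₀ by linarith,
    show -(q * η) ^ 4 = x₀ - q ^ 4 * C / η by linarith] at hlt

theorem extX_eq (hx₀ : x₀ ≤ 0) : extX x₀ = (X x₀ : EReal) :=
  (EReal.coe_toReal (extX_lt_sub_div_eta hx₀).ne_top
    (ne_bot_of_le_ne_bot (EReal.coe_ne_bot _) (coe_Xminus_Xmin_le hx₀))).symm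

end Finiteness

section Bounds

variable {x₀ : ℝ}

theorem Xminus_Xmin_le_X (hx₀ : x₀ ≤ 0) : Xminus (Xmin x₀) ≤ X x₀ := by
  simpa only [extX_eq hx₀, EReal.coe_le_coe_iff] using coe_Xminus_Xmin_le hx₀

theorem X_lt_sub_div_eta (hx₀ : x₀ ≤ 0) :
    X x₀ < x₀ - (2 : ℝ) ^ (4 / 5 : ℝ) * C / eta (x₀ / (2 : ℝ) ^ (4 / 5 : ℝ)) := by
  simpa only [extX_eq hx₀, EReal.coe_lt_coe_iff] using extX_lt_sub_div_eta hx₀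

theorem abs_rpow_lt_eta (x₀ : ℝ) : |x₀| ^ (1 / 4 : ℝ) < eta x₀ := by
  rw [← pow_four_rpow (eta_pos x₀).le]
  exact Real.rpow_lt_rpow (abs_nonneg x₀) (abs_lt_eta_pow_four x₀) (by norm_num)

theorem eta_le_abs_Xmin_rpow (hx₀ : x₀ ≤ 0) : eta x₀ ≤ |Xmin x₀| ^ (1 / 4 : ℝ) := by
  have hη := eta_pos x₀
  have hle : eta x₀ ^ 4 ≤ |Xmin x₀| := by
    linarith [Xmin_le_neg_eta_pow_four hx₀, neg_abs_le (Xmin x₀)]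
  calc eta x₀ = (eta x₀ ^ 4) ^ (1 / 4 : ℝ) := (pow_four_rpow hη.le).symm
    _ ≤ |Xmin x₀| ^ (1 / 4 : ℝ) := by gcongr

theorem sub_div_eta_lt_Xmin_sub (hx₀ : x₀ < 0) :
    x₀ - C / |x₀| ^ (1 / 4 : ℝ) - C / eta x₀ < Xmin x₀ - C / |Xmin x₀| ^ (1 / 4 : ℝ) :=
  (sub_lt_sub_right (lt_Xmin hx₀) _).trans_le <| sub_le_sub_left
    (div_le_div_of_nonneg_left C_pos.le (eta_pos x₀) (eta_le_abs_Xmin_rpow hx₀.le)) _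

theorem Xmin_sub_lt_X (hx₀ : x₀ < 0) : Xmin x₀ - C / |Xmin x₀| ^ (1 / 4 : ℝ) < X x₀ :=
  (lt_Xminus ((Xmin_lt hx₀.le).trans hx₀)).trans_le (Xminus_Xmin_le_X hx₀.le)

theorem X_lt_sub_div_Xmin (hx₀ : x₀ ≤ 0) : X x₀ <
    x₀ - (2 : ℝ) ^ (4 / 5 : ℝ) * C / |Xmin (x₀ / (2 : ℝ) ^ (4 / 5 : ℝ))| ^ (1 / 4 : ℝ) := by
  have hs : (0 : ℝ) < 2 ^ (4 / 5 : ℝ) := by positivity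
  refine (X_lt_sub_div_eta hx₀).trans_le (sub_le_sub_left ?_ _)
  exact div_le_div_of_nonneg_left (mul_pos hs C_pos).le (eta_pos _)
    (eta_le_abs_Xmin_rpow (div_nonpos_of_nonpos_of_nonneg hx₀ hs.le))

theorem abs_Xmin_lt (hx₀ : x₀ < 0) : |Xmin x₀| < |x₀| + C / |x₀| ^ (1 / 4 : ℝ) := by
  have hlt := lt_Xmin hx₀
  rw [abs_of_neg hx₀] at hlt ⊢
  rw [abs_of_neg ((Xmin_lt hx₀.le).trans hx₀)]
  linarith

theorem sub_div_Xmin_lt (hx₀ : x₀ < 0) :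
    x₀ - (2 : ℝ) ^ (4 / 5 : ℝ) * C / |Xmin (x₀ / (2 : ℝ) ^ (4 / 5 : ℝ))| ^ (1 / 4 : ℝ) <
      x₀ - 2 * C / |(|x₀| + 2 * C / |x₀| ^ (1 / 4 : ℝ))| ^ (1 / 4 : ℝ) := by
  obtain ⟨q, hq, hq4, hq5⟩ := exists_two_rpow_eq_pow_four
  have hC := C_pos
  have hw : x₀ / q ^ 4 < 0 := div_neg_of_neg_of_pos hx₀ (pow_pos hq 4)
  have hXmin : 0 < |Xmin (x₀ / q ^ 4)| := abs_pos.2 ((Xmin_lt hw.le).trans hw).ne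
  have hlt := abs_Xmin_lt hw
  rw [hq4]
  obtain ⟨h, hh, rfl⟩ := exists_eq_neg_pow_four hx₀
  rw [show -h ^ 4 / q ^ 4 = -(h / q) ^ 4 by ring] at hlt hXmin ⊢
  rw [abs_neg_pow_four_rpow (div_pos hh hq).le] at hlt
  rw [abs_neg_pow_four] at hlt
  rw [abs_neg_pow_four_rpow hh.le, abs_neg_pow_four]
  have hscale : h ^ 4 + 2 * C / h = q ^ 4 * ((h / q) ^ 4 + C / (h / q)) := by
    rw [← hq5]
    field_simp
  have hsum : 0 < (h / q) ^ 4 + C / (h / q) := by positivity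
  rw [hscale, abs_of_pos (mul_pos (pow_pos hq 4) hsum), Real.mul_rpow (by positivity) hsum.le,
    pow_four_rpow hq.le]
  refine sub_lt_sub_left ?_ _
  calc 2 * C / (q * ((h / q) ^ 4 + C / (h / q)) ^ (1 / 4 : ℝ))
      = q ^ 4 * C / ((h / q) ^ 4 + C / (h / q)) ^ (1 / 4 : ℝ) := by
        rw [← hq5]
        field_simp
    _ < q ^ 4 * C / |Xmin (-(h / q) ^ 4)| ^ (1 / 4 : ℝ) := by gcongr

end Bounds

section Error

variable {x₀ : ℝ}

theorem one_div_sub_one_div_le {a b : ℝ} (ha : 0 < a) (hb : 0 < b) :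
    1 / a - 1 / b ≤ (b ^ 4 - a ^ 4) / (4 * a ^ 5) := by
  have hfactor : (b ^ 4 - a ^ 4) / (4 * a ^ 5) - (1 / a - 1 / b) =
      (b - a) ^ 2 * (b ^ 3 + 2 * b ^ 2 * a + 3 * b * a ^ 2 + 4 * a ^ 3) / (4 * a ^ 5 * b) := by
    field_simp
    ring
  rw [← sub_nonneg, hfactor]
  positivity

theorem error_pos (hx₀ : x₀ < 0) : 0 < X x₀ - (x₀ - 2 * C / |x₀| ^ (1 / 4 : ℝ)) := by
  have hlt := (sub_div_eta_lt_Xmin_sub hx₀).trans (Xmin_sub_lt_X hx₀)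
  have hη : C / eta x₀ < C / |x₀| ^ (1 / 4 : ℝ) :=
    div_lt_div_of_pos_left C_pos (Real.rpow_pos_of_pos (abs_pos.2 hx₀.ne) _) (abs_rpow_lt_eta x₀)
  rw [mul_div_assoc]
  linarith

theorem error_lt (hx₀ : x₀ < 0) :
    X x₀ - (x₀ - 2 * C / |x₀| ^ (1 / 4 : ℝ)) < C ^ 2 / |x₀| ^ (3 / 2 : ℝ) := by
  have hlt := (X_lt_sub_div_Xmin hx₀.le).trans (sub_div_Xmin_lt hx₀)
  have hC := C_pos
  have hpow : |x₀| ^ (3 / 2 : ℝ) = (|x₀| ^ (1 / 4 : ℝ)) ^ 6 := by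
    rw [← Real.rpow_natCast, ← Real.rpow_mul (abs_nonneg x₀)]
    norm_num
  rw [hpow]
  obtain ⟨h, hh, rfl⟩ := exists_eq_neg_pow_four hx₀
  rw [abs_neg_pow_four_rpow hh.le] at hlt ⊢
  rw [abs_neg_pow_four] at hlt
  obtain ⟨k, hk, hk4⟩ := exists_eq_neg_pow_four (x₀ := -(h ^ 4 + 2 * C / h))
    (neg_neg_of_pos (by positivity))
  rw [neg_inj] at hk4
  rw [hk4, abs_of_pos (pow_pos hk 4), pow_four_rpow hk.le] at hlt
  have hdiff : 2 * C / h - 2 * C / k ≤ C ^ 2 / h ^ 6 :=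
    calc 2 * C / h - 2 * C / k = 2 * C * (1 / h - 1 / k) := by ring
      _ ≤ 2 * C * ((k ^ 4 - h ^ 4) / (4 * h ^ 5)) := by
        gcongr
        exact one_div_sub_one_div_le hh hk
      _ = C ^ 2 / h ^ 6 := by
        rw [← hk4]
        field_simp
        ring
  linarith

theorem isBigO_error :
    (fun x₀ : ℝ => X x₀ - (x₀ - 2 * C / |x₀| ^ (1 / 4 : ℝ)))
      =O[atBot] (fun x₀ : ℝ => 1 / |x₀| ^ (3 / 2 : ℝ)) := by
  refine Asymptotics.IsBigO.of_bound (C ^ 2) ?_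
  filter_upwards [eventually_lt_atBot 0] with x hx
  rw [Real.norm_of_nonneg (error_pos hx).le, Real.norm_of_nonneg (by positivity), mul_one_div]
  exact (error_lt hx).le

end Error

end PainleveOne

open PainleveOne in
theorem theorem2p1_general :
    IsGreatest (integralI '' Set.Iio 0) C ∧
    (∀ x₀ : ℝ, x₀ ≤ 0 →
      etaRoots x₀ = {eta x₀} ∧
      extXmin x₀ = (Xmin x₀ : EReal) ∧
      extXminus x₀ = (Xminus x₀ : EReal) ∧
      extX x₀ = (X x₀ : EReal) ∧
      Xminus (Xmin x₀) ≤ X x₀ ∧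
      X x₀ < x₀ - (2 : ℝ) ^ (4 / 5 : ℝ) * C / eta (x₀ / (2 : ℝ) ^ (4 / 5 : ℝ))) ∧
    (∀ x₀ : ℝ, x₀ < 0 →
      x₀ - C / |x₀| ^ (1 / 4 : ℝ) - C / eta x₀ < Xmin x₀ - C / |Xmin x₀| ^ (1 / 4 : ℝ) ∧
      Xmin x₀ - C / |Xmin x₀| ^ (1 / 4 : ℝ) < X x₀ ∧
      X x₀ < x₀ - (2 : ℝ) ^ (4 / 5 : ℝ) * C /
        |Xmin (x₀ / (2 : ℝ) ^ (4 / 5 : ℝ))| ^ (1 / 4 : ℝ) ∧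
      x₀ - (2 : ℝ) ^ (4 / 5 : ℝ) * C / |Xmin (x₀ / (2 : ℝ) ^ (4 / 5 : ℝ))| ^ (1 / 4 : ℝ) <
        x₀ - 2 * C / |(|x₀| + 2 * C / |x₀| ^ (1 / 4 : ℝ))| ^ (1 / 4 : ℝ)) ∧
    (fun x₀ : ℝ => X x₀ - (x₀ - 2 * C / |x₀| ^ (1 / 4 : ℝ)))
      =O[Filter.atBot] (fun x₀ : ℝ => 1 / |x₀| ^ (3 / 2 : ℝ)) ∧
    (∀ x₀ : ℝ, x₀ < 0 →
      0 < X x₀ - (x₀ - 2 * C / |x₀| ^ (1 / 4 : ℝ)) ∧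
      X x₀ - (x₀ - 2 * C / |x₀| ^ (1 / 4 : ℝ)) < C ^ 2 / |x₀| ^ (3 / 2 : ℝ)) :=
  ⟨isGreatest_C,
    fun x₀ hx₀ => ⟨etaRoots_eq x₀, extXmin_eq hx₀, extXminus_eq hx₀, extX_eq hx₀,
      Xminus_Xmin_le_X hx₀, X_lt_sub_div_eta hx₀⟩,
    fun _ hx₀ => ⟨sub_div_eta_lt_Xmin_sub hx₀, Xmin_sub_lt_X hx₀, X_lt_sub_div_Xmin hx₀.le,
      sub_div_Xmin_lt hx₀⟩,
    isBigO_error, fun _ hx₀ => ⟨error_pos hx₀, error_lt hx₀⟩⟩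

theorem theorem2p1 :
    -- `C` is a maximum
    IsGreatest (PainleveOne.integralI '' Set.Iio 0) PainleveOne.C ∧
    (∀ x₀ : ℝ, x₀ ≤ 0 →
      -- `eta x₀` is the unique positive root
      PainleveOne.etaRoots x₀ = {PainleveOne.eta x₀} ∧
      -- the three infima are finite
      PainleveOne.extXmin x₀ = (PainleveOne.Xmin x₀ : EReal) ∧
      PainleveOne.extXminus x₀ = (PainleveOne.Xminus x₀ : EReal) ∧
      PainleveOne.extX x₀ = (PainleveOne.X x₀ : EReal) ∧
      -- two-sided bounds for `x₀ ≤ 0`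
      PainleveOne.Xminus (PainleveOne.Xmin x₀) ≤ PainleveOne.X x₀ ∧
      PainleveOne.X x₀ < x₀ - (2 : ℝ) ^ (4 / 5 : ℝ) * PainleveOne.C /
        PainleveOne.eta (x₀ / (2 : ℝ) ^ (4 / 5 : ℝ))) ∧
    -- two-sided bounds for `x₀ < 0`
    (∀ x₀ : ℝ, x₀ < 0 →
      x₀ - PainleveOne.C / |x₀| ^ (1 / 4 : ℝ) - PainleveOne.C / PainleveOne.eta x₀ <
        PainleveOne.Xmin x₀ - PainleveOne.C / |PainleveOne.Xmin x₀| ^ (1 / 4 : ℝ) ∧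
      PainleveOne.Xmin x₀ - PainleveOne.C / |PainleveOne.Xmin x₀| ^ (1 / 4 : ℝ) <
        PainleveOne.X x₀ ∧
      PainleveOne.X x₀ < x₀ - (2 : ℝ) ^ (4 / 5 : ℝ) * PainleveOne.C /
        |PainleveOne.Xmin (x₀ / (2 : ℝ) ^ (4 / 5 : ℝ))| ^ (1 / 4 : ℝ) ∧
      x₀ - (2 : ℝ) ^ (4 / 5 : ℝ) * PainleveOne.C /
          |PainleveOne.Xmin (x₀ / (2 : ℝ) ^ (4 / 5 : ℝ))| ^ (1 / 4 : ℝ) <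
        x₀ - 2 * PainleveOne.C /
          |(|x₀| + 2 * PainleveOne.C / |x₀| ^ (1 / 4 : ℝ))| ^ (1 / 4 : ℝ)) ∧
    -- asymptotics as `x₀ → -∞`
    (fun x₀ : ℝ => PainleveOne.X x₀ - (x₀ - 2 * PainleveOne.C / |x₀| ^ (1 / 4 : ℝ)))
      =O[Filter.atBot] (fun x₀ : ℝ => 1 / |x₀| ^ (3 / 2 : ℝ)) ∧
    -- explicit bound on the error term
    (∀ x₀ : ℝ, x₀ ≤ 0 → (2 * PainleveOne.C) ^ (4 / 5 : ℝ) < |x₀| →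
      0 < PainleveOne.X x₀ - (x₀ - 2 * PainleveOne.C / |x₀| ^ (1 / 4 : ℝ)) ∧
      PainleveOne.X x₀ - (x₀ - 2 * PainleveOne.C / |x₀| ^ (1 / 4 : ℝ)) <
        PainleveOne.C ^ 2 / |x₀| ^ (3 / 2 : ℝ)) := by
  obtain ⟨hC, hnonpos, hneg, herror, hbound⟩ := theorem2p1_general
  refine ⟨hC, hnonpos, hneg, herror, fun x₀ hx₀ hlarge => hbound x₀ (hx₀.lt_of_ne ?_)⟩
  exact abs_pos.1 ((Real.rpow_nonneg (mul_pos two_pos PainleveOne.C_pos).le _).trans_lt hlarge)
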